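/- **Windows Scheduling** (one machine, unit-length jobs, exact periods): given positive integers $p_1,\dots,p_n$, decide whether there is an assignment of at most one job to every time slot $0,1,2,\dots$ such that each job $j$ is executed infinitely often and any two consecutive executions of $j$ are exactly $p_j$ slots apart. Given start times $t_j\in\{0,\dots,p_j-1\}$, job $j$ is to be executed in the slots $t_j,t_j+p_j,t_j+2p_j,\dots$; two jobs *collide* if they have to be executed in the same slot, and start times are *feasible* if no two distinct jobs collide. **Partial Coding**: given attributes $1,\dots,d$ with value ranges $f_i\ge 2$ and symbols $s_1,\dots,s_n\subseteq\{1,\dots,d\}$, an *encoding* of $s_j$ is a map $c_j$ with $c_j(i)\in\{0,\dots,f_i-1\}$ for $i\in s_j$; two symbols $s_j,s_k$ are *distinguishable* if $c_j(i)\ne c_k(i)$ for some $i\in s_j\cap s_k$; encodings $c_1,\dots,c_n$ are *feasible* if any two symbols with different indices are distinguishable. Decide whether feasible encodings exist. A *relative prime factorization* of $p_1,\dots,p_n$ is a vector $F=(f_1,\dots,f_d)$ of positive integers with $f_1\le\dots\le f_d$, any two components being equal or relatively prime, such that each $p_j$ is a product $\prod_{i\in s}f_i$ for some $s\subseteq\{1,\dots,d\}$.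 *gcd splitting* repeatedly replaces, in a multiset of integers, two members $x\neq y$ with $g=\gcd(x,y)\ne1$ by $x/g,\ g,\ y/g$, until this is no longer possible. The *residue vector* of $x$ with respect to $F$ has the components $r_i(x)=\lfloor x/f_i^{h}\rfloor \bmod f_i$ with $h=\max\{i-j : f_j=f_i\}$. **Theorem.** There is a map, computable in time polynomial in the binary length of the input (on a random access machine with logarithmic cost), that sends each Windows Scheduling instance $p_1,\dots,p_n$ to a Partial Coding instance with $n$ symbols, value ranges $F=(f_1,\dots,f_d)$ and symbols $s_1,\dots,s_n$ such that: 1. $F$ is a relative prime factorization of $p_1,\dots,p_n$, and the set of values occurring in $F$ is the set of members different from $1$ of a multiset obtained from $\{p_1,\dots,p_n\}$ by gcd splitting carried out to the end (a value may be repeated in $F$); 2. $s_j$ is the lexicographically smallest index set with $\prod_{i\in s_j}f_i=p_j$, for each $j$; 3. for each $j$, the map $t\mapsto (r_i(t))_{i\in s_j}$ is a bijection from $\{0,\dots,p_j-1\}$ onto the encodings of $s_j$; 4. for all start times $t_1,\dots,t_n$ and all $j\ne k$, the jobs $j$ and $k$ collide if and only if the symbols $s_j$ and $s_k$ are not distinguishable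 under the encodings $c_l(i)=r_i(t_l)$; hence start times are feasible if and only if the corresponding encodings are feasible; 5. the Windows Scheduling instance is solvable if and only if the Partial Coding instance is solvable. In particular, Windows Scheduling reduces to Partial Coding in polynomial time. -/

import Mathlib

/-! ### Polynomial time: random access machines with logarithmic cost -/

namespace RAM

/-- Memory of a random access machine: natural-number registers, and arrays of natural-number
cells. A program mentions only finitely many registers and arrays. -/
structure State where
  reg : ℕ → ℕ
  arr : ℕ → ℕ → ℕ

/-- Overwrite register `x` by `v`. -/
def State.setReg (σ : State) (x v : ℕ) : State :=
  { σ with reg := Function.update σ.reg x v }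

/-- Overwrite cell `i` of array `a` by `v`. -/
def State.setCell (σ : State) (a i v : ℕ) : State :=
  { σ with arr := Function.update σ.arr a (Function.update (σ.arr a) i v) }

/-- The arithmetic instructions (`sub` is truncated subtraction, `div` is integer division). -/
inductive Op
  | add | sub | mul | div

/-- The value of an arithmetic instruction. -/
def Op.eval : Op → ℕ → ℕ → ℕ
  | .add, m, n => m + n
  | .sub, m, n => m - n
  | .mul, m, n => m * n
  | .div, m, n => m / n

/-- Structured programs of the random access machine. -/
inductive Prog
  /-- Do nothing. -/
  | skip
  /-- `x := v` for a constant `v`. -/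
  | const (x v : ℕ)
  /-- `x := y op z` for registers `x`, `y`, `z`. -/
  | arith (op : Op) (x y z : ℕ)
  /-- `x := a[y]` for registers `x`, `y` and an array `a` (indirect addressing). -/
  | load (x a y : ℕ)
  /-- `a[y] := x` for registers `x`, `y` and an array `a` (indirect addressing). -/
  | store (a y x : ℕ)
  /-- Sequential composition. -/
  | seq (p q : Prog)
  /-- Run `p` if register `x` is nonzero, and `q` otherwise. -/
  | ite (x : ℕ) (p q : Prog)
  /-- Repeat `p` as long as register `x` is nonzero. -/
  | loop (x : ℕ) (p : Prog)

/-- `Exec p σ c τ`: started in `σ`, the program `p` halts in `τ` with total cost `c`. Every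
executed instruction or test costs one unit plus the binary lengths of all numbers that it
handles, addresses included (logarithmic cost). -/
inductive Exec : Prog → State → ℕ → State → Prop
  | skip (σ : State) : Exec .skip σ 1 σ
  | const (σ : State) (x v : ℕ) : Exec (.const x v) σ (1 + v.size) (σ.setReg x v)
  | arith (σ : State) (op : Op) (x y z : ℕ) :
      Exec (.arith op x y z) σ
        (1 + (σ.reg y).size + (σ.reg z).size + (op.eval (σ.reg y) (σ.reg z)).size)
        (σ.setReg x (op.eval (σ.reg y) (σ.reg z)))
  | load (σ : State) (x a y : ℕ) :
      Exec (.load x a y) σ (1 + (σ.reg y).size + (σ.arr a (σ.reg y)).size)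
        (σ.setReg x (σ.arr a (σ.reg y)))
  | store (σ : State) (a y x : ℕ) :
      Exec (.store a y x) σ (1 + (σ.reg y).size + (σ.reg x).size)
        (σ.setCell a (σ.reg y) (σ.reg x))
  | seq {p q : Prog} {σ τ ρ : State} {c c' : ℕ} (hp : Exec p σ c τ) (hq : Exec q τ c' ρ) :
      Exec (.seq p q) σ (c + c') ρ
  | iteTrue {x : ℕ} {p q : Prog} {σ τ : State} {c : ℕ} (hx : σ.reg x ≠ 0) (hp : Exec p σ c τ) :
      Exec (.ite x p q) σ (1 + (σ.reg x).size + c) τ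
  | iteFalse {x : ℕ} {p q : Prog} {σ τ : State} {c : ℕ} (hx : σ.reg x = 0) (hq : Exec q σ c τ) :
      Exec (.ite x p q) σ (1 + (σ.reg x).size + c) τ
  | loopStop {x : ℕ} {p : Prog} {σ : State} (hx : σ.reg x = 0) :
      Exec (.loop x p) σ (1 + (σ.reg x).size) σ
  | loopStep {x : ℕ} {p : Prog} {σ τ ρ : State} {c c' : ℕ} (hx : σ.reg x ≠ 0)
      (hp : Exec p σ c τ) (hl : Exec (.loop x p) τ c' ρ) :
      Exec (.loop x p) σ (1 + (σ.reg x).size + c + c') ρ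

/-- The initial memory on input `l`: register `0` holds the length of `l`, array `0` holds the
entries of `l`, everything else is `0`. -/
def input (l : List ℕ) : State where
  reg x := if x = 0 then l.length else 0
  arr a i := if a = 0 then l.getD i 0 else 0

/-- The output in a final memory: the list whose length is in register `0` and whose entries are
in array `0`. -/
def State.output (σ : State) : List ℕ :=
  (List.range (σ.reg 0)).map (σ.arr 0)

/-- The length of the binary representation of a list of numbers, one separator per entry
included. -/
def bitSize (l : List ℕ) : ℕ :=
  (l.map fun v => v.size + 1).sum

/-- The map that sends the object encoded by `inp a` to the object encoded by `out a` is
computable in time polynomial in the binary length of the input: one program halts on every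
input `inp a` with output `out a` within polynomial cost. -/
def PolyTimeComputable {α : Type} (inp out : α → List ℕ) : Prop :=
  ∃ (p : Prog) (b : Polynomial ℕ), ∀ a : α, ∃ (c : ℕ) (τ : State),
    Exec p (input (inp a)) c τ ∧ τ.output = out a ∧ c ≤ b.eval (bitSize (inp a))

end RAM

/-! ### Windows Scheduling: one machine, unit-length jobs, exact periods -/

/-- An instance of Windows Scheduling: `n` unit-length jobs with positive integer periods. -/
structure WSInstance where
  n : ℕ
  p : Fin n → ℕ
  pos : ∀ j, 0 < p j

namespace WSInstance

/-- `S t` is the job that the machine executes in time slot `t`, if any. The schedule solves the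
instance if every job is executed infinitely often, with exactly `p j` time units between any two
consecutive executions of job `j`. -/
def IsSolution (P : WSInstance) (S : ℕ → Option (Fin P.n)) : Prop :=
  ∀ j, (∀ N, ∃ t ≥ N, S t = some j) ∧
    ∀ t t', t < t' → S t = some j → S t' = some j →
      (∀ u, t < u → u < t' → S u ≠ some j) → t' - t = P.p j

/-- The Windows Scheduling decision problem. -/
def Solvable (P : WSInstance) : Prop :=
  ∃ S, P.IsSolution S

/-- Start times: a number in `[0, p j - 1]` for each job `j`. -/
abbrev StartTimes (P : WSInstance) : Type :=
  ∀ j, Fin (P.p j)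

/-- The time slots in which job `j` has to be executed, given the start times. -/
def execTimes (P : WSInstance) (t : P.StartTimes) (j : Fin P.n) : Set ℕ :=
  {u | ∃ k : ℕ, u = t j + k * P.p j}

/-- Two jobs collide if they have to be executed at the same time. -/
def Collide (P : WSInstance) (t : P.StartTimes) (j k : Fin P.n) : Prop :=
  ∃ u, u ∈ P.execTimes t j ∧ u ∈ P.execTimes t k

/-- Start times are feasible if no two distinct jobs collide. -/
def FeasibleStart (P : WSInstance) (t : P.StartTimes) : Prop :=
  ∀ j k, j ≠ k → ¬ P.Collide t j k

/-- Representation of an instance: the list of the periods. -/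
def encode (P : WSInstance) : List ℕ :=
  List.ofFn P.p

end WSInstance

/-! ### Partial Coding -/

/-- An instance of Partial Coding with `n` symbols: `d` attributes with value ranges
`[0, f i - 1]`, where `f i ≥ 2`, and the set `s j` of the attributes of each symbol `j`. -/
structure PCInstance (n : ℕ) where
  d : ℕ
  f : Fin d → ℕ
  two_le : ∀ i, 2 ≤ f i
  s : Fin n → Finset (Fin d)

namespace PCInstance

variable {n : ℕ}

/-- The encodings of symbol `j`: a value in `[0, f i - 1]` for each attribute `i` of the symbol. -/
abbrev Encoding (Q : PCInstance n) (j : Fin n) : Type :=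
  ∀ i : {i // i ∈ Q.s j}, Fin (Q.f i)

/-- The symbols `j` and `k` differ in an attribute that they have in common. -/
def Distinguishable (Q : PCInstance n) (c : ∀ j, Q.Encoding j) (j k : Fin n) : Prop :=
  ∃ (i : Fin Q.d) (hj : i ∈ Q.s j) (hk : i ∈ Q.s k), c j ⟨i, hj⟩ ≠ c k ⟨i, hk⟩

/-- A collection of encodings is feasible if any two symbols are distinguishable. -/
def Feasible (Q : PCInstance n) (c : ∀ j, Q.Encoding j) : Prop :=
  ∀ j k, j ≠ k → Q.Distinguishable c j k

/-- The Partial Coding decision problem. -/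
def Solvable (Q : PCInstance n) : Prop :=
  ∃ c, Q.Feasible c

/-- Representation of an instance: the number of attributes, the number of symbols, the value
ranges, and for each symbol the `0`-`1` incidence vector of its set of attributes. -/
def encode (Q : PCInstance n) : List ℕ :=
  Q.d :: n :: (List.ofFn Q.f ++
    (List.ofFn fun j => List.ofFn fun i => if i ∈ Q.s j then 1 else 0).flatten)

end PCInstance

/-! ### Relative prime factorizations, gcd splitting and residue vectors -/

/-- Relative prime vectors: nondecreasing vectors of positive integers any two of which are equal
or relatively prime. -/
def IsRelativePrimeVector {d : ℕ} (f : Fin d → ℕ) : Prop :=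
  (∀ i, 0 < f i) ∧ Monotone f ∧ ∀ i j, f i = f j ∨ (f i).Coprime (f j)

/-- `f` is a relative prime factorization of `p`: a relative prime vector such that each `p j` is
the product of the components of `f` over some index set. -/
def IsRelativePrimeFactorization {d n : ℕ} (f : Fin d → ℕ) (p : Fin n → ℕ) : Prop :=
  IsRelativePrimeVector f ∧ ∀ j, ∃ s : Finset (Fin d), ∏ i ∈ s, f i = p j

/-- `s` is the lexicographically smallest index set (listed increasingly) with
`∏ i ∈ s, f i = m`. -/
def IsLexLeastIndexSet {d : ℕ} (f : Fin d → ℕ) (m : ℕ) (s : Finset (Fin d)) : Prop :=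
  ∏ i ∈ s, f i = m ∧ ∀ s' : Finset (Fin d), ∏ i ∈ s', f i = m → s.sort ≤ s'.sort

/-- One step of gcd splitting: two distinct members `x`, `y` that are not relatively prime are
replaced by `x / g`, `g`, `y / g`, where `g` is their greatest common divisor. -/
def SplitStep (M M' : Multiset ℕ) : Prop :=
  ∃ (x y : ℕ) (R : Multiset ℕ), M = x ::ₘ y ::ₘ R ∧ x ≠ y ∧ Nat.gcd x y ≠ 1 ∧
    M' = (x / Nat.gcd x y) ::ₘ Nat.gcd x y ::ₘ (y / Nat.gcd x y) ::ₘ R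

/-- `M'` is a final result of gcd splitting started from `M`. -/
def IsSplitResult (M M' : Multiset ℕ) : Prop :=
  Relation.ReflTransGen SplitStep M M' ∧ ∀ M'', ¬ SplitStep M' M''

/-- The largest `i - j` with `f j = f i`. -/
def residueExponent {d : ℕ} (f : Fin d → ℕ) (i : Fin d) : ℕ :=
  (Finset.univ.filter fun j => f j = f i).sup fun j => (i : ℕ) - (j : ℕ)

/-- The `i`-th component of the residue vector of `x` with respect to `f`. -/
def residue {d : ℕ} (f : Fin d → ℕ) (i : Fin d) (x : ℕ) : ℕ :=
  x / f i ^ residueExponent f i % f i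

/-- The encoding of symbol `j` by the components of the residue vector of `x` that belong to the
attributes of the symbol. -/
def PCInstance.residueEncoding {n : ℕ} (Q : PCInstance n) (j : Fin n) (x : ℕ) : Q.Encoding j :=
  fun i => ⟨residue Q.f i x, Nat.mod_lt _ (lt_of_lt_of_le Nat.zero_lt_two (Q.two_le i))⟩

/-! Run gcd splitting to the end and let `V` be the set of members different from 1. `V` is pairwise
coprime and every period is a product of its members, so over `V` there is unique factorization `p j
= ∏ v ^ e v`, although the `v` need not be prime. The attributes are the pairs `(v, h)` for which `v
^ (h + 1)` divides some period, in lexicographic order; symbol `j` gets those with `v ^ (h + 1) ∣ p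
j`, that is, `h < e v`.

The residue at `(v, h)` is the `h`-th base-`v` digit of `t`. The digits below `e` determine `t`
modulo `v ^ e`, and by the Chinese remainder theorem the digits at the attributes of `m` determine
`t` modulo `m` (`residue_eq_iff_modEq`). With `m = p j` this makes start times and encodings
correspond bijectively. The attributes common to `j` and `k` are those of `gcd (p j) (p k)`, so the
symbols are indistinguishable exactly when `t j ≡ t k` modulo that gcd (`not_distinguishable_iff`),
which is also the condition for two arithmetic progressions to meet (`WSInstance.collide_iff`).
Exact periods force every schedule to be given by start times, so solvability transfers.

Polynomial time rests on a potential: a splitting step divides the product of the multiset by `g ≥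
2` and adds one member, so `M.prod * 2 ^ M.card` never increases. For input length `L` there are
thus never more than `2 * L` members, all divisors of periods. The programs are verified with a
Hoare-style predicate `Within`, which bounds the word length and the number of instructions;
together these bound the logarithmic cost. -/

/-! ### Coprime bases -/

/-- A finite set of pairwise coprime integers that are at least `2`. -/
def IsCoprimeBase (V : Finset ℕ) : Prop :=
  (∀ v ∈ V, 2 ≤ v) ∧ ∀ u ∈ V, ∀ v ∈ V, u ≠ v → u.Coprime v

/-- The cofactor of `v ^ e v` is coprime to `v`, so only that factor matters. This is the substitute
for the `p`-adic valuation when `v` is not prime. -/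
theorem pow_dvd_prod_pow_iff {V : Finset ℕ} (hV : IsCoprimeBase V) (e : ℕ → ℕ) {v : ℕ}
    (hv : v ∈ V) (k : ℕ) : v ^ k ∣ ∏ u ∈ V, u ^ e u ↔ k ≤ e v := by
  rw [← Finset.mul_prod_erase V _ hv]
  have hc : (v ^ k).Coprime (∏ u ∈ V.erase v, u ^ e u) := by
    refine Nat.Coprime.prod_right fun u hu => Nat.Coprime.pow _ _ ?_
    exact hV.2 v hv u (Finset.mem_of_mem_erase hu) (Finset.ne_of_mem_erase hu).symm
  rw [hc.dvd_mul_right]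
  exact Nat.pow_dvd_pow_iff_le_right (hV.1 v hv)

theorem prod_pow_inj {V : Finset ℕ} (hV : IsCoprimeBase V) {e e' : ℕ → ℕ}
    (h : ∏ u ∈ V, u ^ e u = ∏ u ∈ V, u ^ e' u) {v : ℕ} (hv : v ∈ V) : e v = e' v := by
  apply le_antisymm
  · rw [← pow_dvd_prod_pow_iff hV e' hv, ← h, pow_dvd_prod_pow_iff hV e hv]
  · rw [← pow_dvd_prod_pow_iff hV e hv, h, pow_dvd_prod_pow_iff hV e' hv]

theorem exists_prod_pow_of_mem_closure {V : Finset ℕ} {m : ℕ}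
    (hm : m ∈ Submonoid.closure (V : Set ℕ)) : ∃ e : ℕ → ℕ, ∏ v ∈ V, v ^ e v = m := by
  induction hm using Submonoid.closure_induction with
  | mem x hx =>
    refine ⟨Pi.single x 1, ?_⟩
    rw [Finset.prod_eq_single x]
    · simp
    · intro b _ hb; simp [hb]
    · intro h; exact absurd hx h
  | one => exact ⟨0, by simp⟩
  | mul x y _ _ hx hy =>
    obtain ⟨e, rfl⟩ := hx
    obtain ⟨e', rfl⟩ := hy
    exact ⟨e + e', by simp [pow_add, Finset.prod_mul_distrib]⟩

/-- After the common factor with exponents `min` is split off, the cofactors are coprime: for each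
`v`, one of the two truncated differences is `0`. -/
theorem gcd_prod_pow {V : Finset ℕ} (hV : IsCoprimeBase V) (e e' : ℕ → ℕ) :
    Nat.gcd (∏ v ∈ V, v ^ e v) (∏ v ∈ V, v ^ e' v) = ∏ v ∈ V, v ^ min (e v) (e' v) := by
  have key : ∀ a b : ℕ → ℕ, ∏ v ∈ V, v ^ a v =
      (∏ v ∈ V, v ^ min (a v) (b v)) * ∏ v ∈ V, v ^ (a v - b v) := by
    intro a b
    rw [← Finset.prod_mul_distrib]
    refine Finset.prod_congr rfl fun v _ => ?_
    rw [← pow_add]; congr 1; omega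
  have h1 := key e e'
  have h2 := key e' e
  simp only [min_comm (e' _)] at h2
  rw [h1, h2, Nat.gcd_mul_left]
  have : Nat.Coprime (∏ v ∈ V, v ^ (e v - e' v)) (∏ v ∈ V, v ^ (e' v - e v)) := by
    refine Nat.Coprime.prod_left fun u hu => Nat.Coprime.prod_right fun v hv => ?_
    by_cases huv : u = v
    · subst huv
      rcases le_total (e u) (e' u) with h | h
      · simp [Nat.sub_eq_zero_of_le h]
      · simp [Nat.sub_eq_zero_of_le h]
    · exact Nat.Coprime.pow _ _ (hV.2 u hu v hv huv)
  rw [this.gcd_eq_one, mul_one]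

/-! ### Digits and the Chinese remainder theorem -/

/-- Induction on `e`, from `a % v ^ (e + 1) = a % v ^ e + v ^ e * (a / v ^ e % v)`. -/
theorem digits_eq_iff_modEq_pow {v : ℕ} (hv : 0 < v) (a b e : ℕ) :
    (∀ h < e, a / v ^ h % v = b / v ^ h % v) ↔ a ≡ b [MOD v ^ e] := by
  induction e with
  | zero => simp [Nat.modEq_one]
  | succ e ih =>
    have hpos : 0 < v ^ e := pow_pos hv e
    constructor
    · intro h
      have h1 : a % v ^ e = b % v ^ e := ih.1 fun k hk => h k (hk.trans (Nat.lt_succ_self e))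
      have h2 := h e (Nat.lt_succ_self e)
      show a % v ^ (e + 1) = b % v ^ (e + 1)
      rw [Nat.mod_pow_succ, Nat.mod_pow_succ, h1, h2]
    · intro h k hk
      have h1 : a ≡ b [MOD v ^ e] := h.of_dvd (pow_dvd_pow v (Nat.le_succ e))
      rcases Nat.lt_succ_iff_lt_or_eq.1 hk with hk | rfl
      · exact ih.2 h1 k hk
      · have h2 : a % v ^ (k + 1) = b % v ^ (k + 1) := h
        have h3 : a % v ^ k = b % v ^ k := h1
        rw [Nat.mod_pow_succ, Nat.mod_pow_succ, h3] at h2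
        exact Nat.eq_of_mul_eq_mul_left hpos (Nat.add_left_cancel h2)

theorem modEq_prod_iff {V : Finset ℕ} {g : ℕ → ℕ}
    (hg : ∀ u ∈ V, ∀ v ∈ V, u ≠ v → (g u).Coprime (g v)) (a b : ℕ) :
    a ≡ b [MOD ∏ v ∈ V, g v] ↔ ∀ v ∈ V, a ≡ b [MOD g v] := by
  constructor
  · intro h v hv
    exact h.of_dvd (Finset.dvd_prod_of_mem g hv)
  · intro h
    rw [Nat.modEq_iff_dvd, Nat.cast_prod]
    refine Finset.prod_dvd_of_coprime ?_ fun v hv => (Nat.modEq_iff_dvd).1 (h v hv)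
    intro u hu v hv huv
    exact Nat.isCoprime_iff_coprime.2 (hg u hu v hv huv)

theorem modEq_prod_pow_iff {V : Finset ℕ} (hV : IsCoprimeBase V) (e : ℕ → ℕ) (a b : ℕ) :
    a ≡ b [MOD ∏ v ∈ V, v ^ e v] ↔
      ∀ v ∈ V, ∀ h < e v, a / v ^ h % v = b / v ^ h % v := by
  rw [modEq_prod_iff fun u hu v hv huv => Nat.Coprime.pow _ _ (hV.2 u hu v hv huv)]
  refine forall₂_congr fun v hv => (digits_eq_iff_modEq_pow ?_ a b _).symm
  exact lt_of_lt_of_le two_pos (hV.1 v hv)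

/-! ### Lexicographic order of index sets -/

/-- The element of `l'` beyond `m` excludes the case that `l'` ends where the lists part; a proper
prefix would be the smaller list. -/
theorem List.lt_of_first_difference {α : Type*} [LinearOrder α] {m : α} :
    ∀ {l l' : List α}, l.Pairwise (· < ·) → l'.Pairwise (· < ·) →
      (∀ a < m, a ∈ l ↔ a ∈ l') → m ∈ l → m ∉ l' → (∃ b ∈ l', m < b) → l < l'
  | [], _, _, _, _, hm, _, _ => by simp at hm
  | _ :: _, [], _, _, _, _, _, hb => by simp at hb
  | a :: t, b :: t', hl, hl', hag, hm, hm', hb => by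
    rw [List.pairwise_cons] at hl hl'
    rw [List.cons_lt_cons_iff]
    have ham : a ≤ m := by
      rcases List.mem_cons.1 hm with h | h
      · exact h.ge
      · exact (hl.1 m h).le
    have hle : ∀ x ∈ b :: t', b ≤ x := by
      intro x hx
      rcases List.mem_cons.1 hx with h | h
      · exact h.ge
      · exact (hl'.1 x h).le
    have hle' : ∀ x ∈ a :: t, a ≤ x := by
      intro x hx
      rcases List.mem_cons.1 hx with h | h
      · exact h.ge
      · exact (hl.1 x h).le
    -- If `b < m`, both heads lie below `m`, so they agree and the tails are compared. Otherwise `b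
    -- > m ≥ a`, and the heads decide.
    rcases lt_or_ge b m with hbm | hbm
    · have hba : b ∈ a :: t := (hag b hbm).2 (by simp)
      have hab : a ≤ b := hle' b hba
      have hb' : a ∈ b :: t' := (hag a (hab.trans_lt hbm)).1 (by simp)
      have heq : a = b := le_antisymm hab (hle a hb')
      subst heq
      right
      refine ⟨rfl, List.lt_of_first_difference (m := m) hl.2 hl'.2 ?_ ?_ ?_ ?_⟩
      · intro x hx
        have := hag x hx
        simp only [List.mem_cons] at this
        constructor
        · intro h
          exact (this.1 (Or.inr h)).resolve_left (hl.1 x h).ne'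
        · intro h
          exact (this.2 (Or.inr h)).resolve_left (hl'.1 x h).ne'
      · exact (List.mem_cons.1 hm).resolve_left hbm.ne'
      · exact fun h => hm' (List.mem_cons_of_mem _ h)
      · obtain ⟨c, hc, hmc⟩ := hb
        rcases List.mem_cons.1 hc with rfl | hc
        · exact absurd hmc (not_lt.2 hbm.le)
        · exact ⟨c, hc, hmc⟩
    · left
      refine ham.trans_lt (lt_of_le_of_ne hbm ?_)
      rintro rfl
      exact hm' (by simp)

theorem Finset.sort_le_sort_of_first_difference {d : ℕ} {s s' : Finset (Fin d)}
    (h : ∀ m, (∀ a < m, a ∈ s ↔ a ∈ s') → (m ∈ s ↔ m ∉ s') → m ∈ s ∧ ∃ b ∈ s', m < b) :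
    s.sort ≤ s'.sort := by
  by_cases hss : s = s'
  · subst hss; exact le_refl _
  have hne : ∃ m, ¬ (m ∈ s ↔ m ∈ s') := by
    by_contra hcon
    push Not at hcon
    exact hss (Finset.ext hcon)
  have hne' : (Finset.univ.filter fun m => ¬ (m ∈ s ↔ m ∈ s')).Nonempty := by
    obtain ⟨m, hm⟩ := hne
    exact ⟨m, by simpa using hm⟩
  obtain ⟨m, hm, hmin⟩ := Finset.exists_min_image _ id hne'
  rw [Finset.mem_filter] at hm
  have hlt : ∀ a < m, a ∈ s ↔ a ∈ s' := by
    intro a ha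
    by_contra hcon
    exact absurd (hmin a (by simpa using hcon)) (not_le.2 ha)
  have hmm : m ∈ s ↔ m ∉ s' := by tauto
  obtain ⟨hms, b, hb, hmb⟩ := h m hlt hmm
  apply le_of_lt
  refine List.lt_of_first_difference (m := m) (Finset.sortedLT_sort s).pairwise
    (Finset.sortedLT_sort s').pairwise ?_ ?_ ?_ ⟨b, ?_, hmb⟩
  · simpa using hlt
  · simpa using hms
  · simpa using hmm.1 hms
  · simpa using hb

/-! ### The Partial Coding instance of a coprime base -/

/-- The pairs `(f i, h i)` list, in strictly increasing lexicographic order, all pairs `(x, k)` for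
which `x` belongs to the coprime base `V` and `x ^ (k + 1)` divides some `p j`. -/
structure IsDigitCode {n d : ℕ} (p : Fin n → ℕ) (V : Finset ℕ) (f h : Fin d → ℕ) : Prop where
  base : IsCoprimeBase V
  generates : ∀ j, p j ∈ Submonoid.closure (V : Set ℕ)
  dvd : ∀ x ∈ V, ∃ j, x ∣ p j
  lex : ∀ i k, i < k → f i < f k ∨ f i = f k ∧ h i < h k
  mem_iff : ∀ x k, (∃ i, f i = x ∧ h i = k) ↔ x ∈ V ∧ ∃ j, x ^ (k + 1) ∣ p j

namespace IsDigitCode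

variable {n d : ℕ} {p : Fin n → ℕ} {V : Finset ℕ} {f h : Fin d → ℕ}

theorem mem (C : IsDigitCode p V f h) (i : Fin d) : f i ∈ V :=
  ((C.mem_iff _ _).1 ⟨i, rfl, rfl⟩).1

theorem two_le (C : IsDigitCode p V f h) (i : Fin d) : 2 ≤ f i :=
  C.base.1 _ (C.mem i)

theorem monotone (C : IsDigitCode p V f h) : Monotone f := by
  intro i k hik
  rcases hik.lt_or_eq with hlt | rfl
  · rcases C.lex i k hlt with h1 | h1
    · exact h1.le
    · exact h1.1.le
  · exact le_refl _

theorem lt_of_eq_of_lt (C : IsDigitCode p V f h) {i k : Fin d} (hf : f i = f k) (hh : h i < h k) :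
    i < k := by
  by_contra hcon
  rcases (not_lt.1 hcon).lt_or_eq with hlt | heq
  · rcases C.lex k i hlt with h1 | h1
    · omega
    · omega
  · subst heq; omega

theorem eq_of_eq (C : IsDigitCode p V f h) {i k : Fin d} (hf : f i = f k) (hh : h i = h k) :
    i = k := by
  rcases lt_trichotomy i k with h1 | h1 | h1
  · rcases C.lex i k h1 with h2 | h2 <;> omega
  · exact h1
  · rcases C.lex k i h1 with h2 | h2 <;> omega

theorem exists_of_le (C : IsDigitCode p V f h) (i : Fin d) {k : ℕ} (hk : k ≤ h i) :
    ∃ l, f l = f i ∧ h l = k := by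
  obtain ⟨h1, j, h2⟩ := (C.mem_iff _ _).1 ⟨i, rfl, rfl⟩
  exact (C.mem_iff _ _).2 ⟨h1, j, (pow_dvd_pow _ (by omega)).trans h2⟩

/-- Within a block of equal values `h` increases strictly by `lex`. It skips nothing, since
divisibility by a power implies divisibility by all lower ones. -/
theorem sub_eq (C : IsDigitCode p V f h) : ∀ (m : ℕ) (k i : Fin d), (i : ℕ) = k + m → f k = f i →
    h i = h k + m := by
  intro m
  induction m with
  | zero =>
    intro k i hki _
    have : i = k := Fin.ext hki
    simp [this]
  | succ m ih =>
    intro k i hki hf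
    let l : Fin d := ⟨k + m, by omega⟩
    have hkl : k ≤ l := Fin.le_def.2 (by simp [l])
    have hli : l < i := Fin.lt_def.2 (by simp [l]; omega)
    have hfl : f k = f l := by
      have h1 := C.monotone hkl
      have h2 := C.monotone hli.le
      omega
    have h1 := ih k l rfl hfl
    have h2 : h l < h i := by
      rcases C.lex l i hli with h3 | h3 <;> omega
    -- A gap would give an index `q` with `h q = h l + 1`, strictly between the neighbours `l` and
    -- `i`.
    by_contra hcon
    obtain ⟨q, hq1, hq2⟩ := C.exists_of_le i (k := h l + 1) (by omega)
    have h3 : l < q := C.lt_of_eq_of_lt (by omega) (by omega)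
    have h4 : q < i := C.lt_of_eq_of_lt (by omega) (by omega)
    rw [Fin.lt_def] at h3 h4
    simp only [l] at h3
    omega

/-- Each block starts with `h = 0` and counts up by one, so the distance of `i` from the start of
its block is `h i`. -/
theorem residueExponent_eq (C : IsDigitCode p V f h) (i : Fin d) : residueExponent f i = h i := by
  apply le_antisymm
  · refine Finset.sup_le fun k hk => ?_
    rw [Finset.mem_filter] at hk
    rcases le_or_gt (k : ℕ) i with hki | hki
    · have := C.sub_eq (i - k) k i (by omega) hk.2
      omega
    · omega
  · obtain ⟨k, hk1, hk2⟩ := C.exists_of_le i (Nat.zero_le _)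
    have hki : k ≤ i := by
      by_contra hcon
      rcases C.lex i k (not_le.1 hcon) with h1 | h1 <;> omega
    have h1 := C.sub_eq (i - k) k i (by rw [Fin.le_def] at hki; omega) hk1
    have h2 : (i : ℕ) - k ≤ residueExponent f i :=
      Finset.le_sup (f := fun j : Fin d => (i : ℕ) - (j : ℕ)) (by simp [hk1])
    omega

/-- The attributes of a number `m`. -/
def attributes (f h : Fin d → ℕ) (m : ℕ) : Finset (Fin d) :=
  Finset.univ.filter fun i => f i ^ (h i + 1) ∣ m

/-- The Partial Coding instance of a coprime base. -/
def toPCInstance (C : IsDigitCode p V f h) : PCInstance n where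
  d := d
  f := f
  two_le := C.two_le
  s j := attributes f h (p j)

theorem exists_exponents (C : IsDigitCode p V f h) (j : Fin n) :
    ∃ e : ℕ → ℕ, ∏ v ∈ V, v ^ e v = p j :=
  exists_prod_pow_of_mem_closure (C.generates j)

theorem mem_attributes (C : IsDigitCode p V f h) {e : ℕ → ℕ} {m : ℕ} (he : ∏ v ∈ V, v ^ e v = m)
    (i : Fin d) : i ∈ attributes f h m ↔ h i < e (f i) := by
  rw [attributes, Finset.mem_filter, ← he, pow_dvd_prod_pow_iff C.base e (C.mem i)]
  simp

/-- Indices exist only for powers that divide a period, hence the condition on `m`; it holds for the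
periods and for their gcds. -/
theorem exists_index (C : IsDigitCode p V f h) {e : ℕ → ℕ} {m : ℕ}
    (he : ∏ v ∈ V, v ^ e v = m) (hm : ∃ j, m ∣ p j) {v k : ℕ} (hv : v ∈ V) (hk : k < e v) :
    ∃ i ∈ attributes f h m, f i = v ∧ h i = k := by
  obtain ⟨j, hj⟩ := hm
  have h1 : v ^ (k + 1) ∣ m := by
    rw [← he, pow_dvd_prod_pow_iff C.base e hv]; exact hk
  obtain ⟨i, hi1, hi2⟩ := (C.mem_iff v k).2 ⟨hv, j, h1.trans hj⟩
  exact ⟨i, (C.mem_attributes he i).2 (by rw [hi1, hi2]; exact hk), hi1, hi2⟩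

theorem prod_eq (C : IsDigitCode p V f h) (s : Finset (Fin d)) :
    ∏ i ∈ s, f i = ∏ v ∈ V, v ^ (s.filter fun i => f i = v).card := by
  rw [← Finset.prod_fiberwise_of_maps_to (s := s) (t := V) (g := f) fun i _ => C.mem i]
  refine Finset.prod_congr rfl fun v _ => ?_
  rw [Finset.prod_congr rfl (g := fun _ => v) (by simp), Finset.prod_const]

theorem card_attributes (C : IsDigitCode p V f h) {e : ℕ → ℕ} {m : ℕ}
    (he : ∏ v ∈ V, v ^ e v = m) (hm : ∃ j, m ∣ p j) {v : ℕ} (hv : v ∈ V) :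
    ((attributes f h m).filter fun i => f i = v).card = e v := by
  rw [← Finset.card_range (e v)]
  refine Finset.card_bij (fun i _ => h i) ?_ ?_ ?_
  · intro i hi
    rw [Finset.mem_filter, C.mem_attributes he] at hi
    rw [Finset.mem_range, ← hi.2]; exact hi.1
  · intro i hi k hk hik
    rw [Finset.mem_filter] at hi hk
    exact C.eq_of_eq (hi.2.trans hk.2.symm) hik
  · intro k hk
    obtain ⟨i, hi, h1, h2⟩ := C.exists_index he hm hv (Finset.mem_range.1 hk)
    exact ⟨i, Finset.mem_filter.2 ⟨hi, h1⟩, h2⟩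

theorem prod_attributes (C : IsDigitCode p V f h) (j : Fin n) :
    ∏ i ∈ attributes f h (p j), f i = p j := by
  obtain ⟨e, he⟩ := C.exists_exponents j
  rw [C.prod_eq, ← he]
  refine Finset.prod_congr rfl fun v hv => ?_
  rw [C.card_attributes rfl ⟨j, by rw [he]⟩ hv]

theorem isRelativePrimeFactorization (C : IsDigitCode p V f h) :
    IsRelativePrimeFactorization f p := by
  refine ⟨⟨fun i => ?_, C.monotone, fun i k => ?_⟩, fun j => ⟨_, C.prod_attributes j⟩⟩
  · have := C.two_le i; omega
  · by_cases hik : f i = f k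
    · exact Or.inl hik
    · exact Or.inr (C.base.2 _ (C.mem i) _ (C.mem k) hik)

theorem range_eq (C : IsDigitCode p V f h) : Set.range f = (V : Set ℕ) := by
  ext x
  constructor
  · rintro ⟨i, rfl⟩
    exact C.mem i
  · intro hx
    obtain ⟨j, hj⟩ := C.dvd x hx
    obtain ⟨i, hi, _⟩ := (C.mem_iff x 0).2 ⟨hx, j, by simpa using hj⟩
    exact ⟨i, hi⟩

/-- By unique factorization, any competitor `s'` has the same number of indices in each block, while
the attributes of `p j` occupy an initial segment of each block. The sets are compared at their
first difference `m`, inside the block of `f m`. -/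
theorem isLexLeastIndexSet (C : IsDigitCode p V f h) (j : Fin n) :
    IsLexLeastIndexSet f (p j) (attributes f h (p j)) := by
  refine ⟨C.prod_attributes j, fun s' hs' => ?_⟩
  obtain ⟨e, he⟩ := C.exists_exponents j
  have hcard : ∀ v ∈ V, (s'.filter fun i => f i = v).card =
      ((attributes f h (p j)).filter fun i => f i = v).card := by
    intro v hv
    refine prod_pow_inj C.base (e := fun v => (s'.filter fun i => f i = v).card)
      (e' := fun v => ((attributes f h (p j)).filter fun i => f i = v).card) ?_ hv
    rw [← C.prod_eq, ← C.prod_eq, hs', C.prod_attributes]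
  refine Finset.sort_le_sort_of_first_difference fun m hag hm => ?_
  by_cases hms : m ∈ attributes f h (p j)
  · refine ⟨hms, ?_⟩
    by_contra hcon
    push Not at hcon
    -- If `s'` had nothing beyond `m`, its part of this block would lie before `m`, hence in the
    -- other set, which also contains `m`.
    have hsub : (s'.filter fun i => f i = f m) ⊂
        ((attributes f h (p j)).filter fun i => f i = f m) := by
      rw [Finset.ssubset_iff_of_subset]
      · exact ⟨m, by simp [hms], by simp [hm.1 hms]⟩
      · intro i hi
        rw [Finset.mem_filter] at hi ⊢
        refine ⟨(hag i (lt_of_le_of_ne (hcon i hi.1) ?_)).2 hi.1, hi.2⟩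
        rintro rfl
        exact hm.1 hms hi.1
    exact absurd (hcard _ (C.mem m)) (Finset.card_lt_card hsub).ne
  · exfalso
    have hms' : m ∈ s' := by tauto
    -- Since `m` is not an attribute of `p j`, all attributes of `p j` in this block come before
    -- `m`, where the two sets agree.
    have hsub : ((attributes f h (p j)).filter fun i => f i = f m) ⊂
        (s'.filter fun i => f i = f m) := by
      rw [Finset.ssubset_iff_of_subset]
      · exact ⟨m, by simp [hms'], by simp [hms]⟩
      · intro i hi
        rw [Finset.mem_filter] at hi ⊢
        refine ⟨(hag i ?_).1 hi.1, hi.2⟩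
        have h1 := (C.mem_attributes he i).1 hi.1
        have h2 : ¬ h m < e (f m) := fun hh => hms ((C.mem_attributes he m).2 hh)
        rw [hi.2] at h1
        exact C.lt_of_eq_of_lt hi.2 (by omega)
    exact absurd (hcard _ (C.mem m)) (Finset.card_lt_card hsub).ne'

/-- The attributes of `m` with value `v` are the digit positions below `e v`, so this is digit
expansion combined with the Chinese remainder theorem. -/
theorem residue_eq_iff_modEq (C : IsDigitCode p V f h) {e : ℕ → ℕ} {m : ℕ}
    (he : ∏ v ∈ V, v ^ e v = m) (hm : ∃ j, m ∣ p j) (a b : ℕ) :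
    (∀ i ∈ attributes f h m, residue f i a = residue f i b) ↔ a ≡ b [MOD m] := by
  rw [← he, modEq_prod_pow_iff C.base, he]
  simp only [residue, C.residueExponent_eq]
  constructor
  · intro H v hv k hk
    obtain ⟨i, hi, rfl, rfl⟩ := C.exists_index he hm hv hk
    exact H i hi
  · intro H i hi
    exact H _ (C.mem i) _ ((C.mem_attributes he i).1 hi)

theorem residueEncoding_bijective (C : IsDigitCode p V f h) (j : Fin n) :
    Function.Bijective (fun t : Fin (p j) => C.toPCInstance.residueEncoding j (t : ℕ)) := by
  rw [Fintype.bijective_iff_injective_and_card]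
  constructor
  · intro a b hab
    obtain ⟨e, he⟩ := C.exists_exponents j
    have h1 : (a : ℕ) ≡ b [MOD p j] := by
      rw [← C.residue_eq_iff_modEq he ⟨j, dvd_rfl⟩]
      intro i hi
      have := congrFun hab ⟨i, hi⟩
      exact congrArg Fin.val this
    exact Fin.ext (h1.eq_of_lt_of_lt a.2 b.2)
  -- Both sides have `p j` elements, as the product of the value ranges of symbol `j` is `p j`.
  · rw [Fintype.card_fin, Fintype.card_pi]
    simp only [Fintype.card_fin]
    rw [Finset.univ_eq_attach, Finset.prod_attach (C.toPCInstance.s j) C.toPCInstance.f]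
    exact (C.prod_attributes j).symm

/-- A power divides both periods exactly when it divides their gcd, so the shared attributes are the
attributes of the gcd. -/
theorem not_distinguishable_iff (C : IsDigitCode p V f h) (t : Fin n → ℕ) (j k : Fin n) :
    ¬ C.toPCInstance.Distinguishable (fun l => C.toPCInstance.residueEncoding l (t l)) j k ↔
      t j ≡ t k [MOD Nat.gcd (p j) (p k)] := by
  obtain ⟨e, he⟩ := C.exists_exponents j
  obtain ⟨e', he'⟩ := C.exists_exponents k
  have hg : ∏ v ∈ V, v ^ min (e v) (e' v) = Nat.gcd (p j) (p k) := by
    rw [← gcd_prod_pow C.base, he, he']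
  rw [← C.residue_eq_iff_modEq hg ⟨j, Nat.gcd_dvd_left _ _⟩]
  have hmem : ∀ i, i ∈ attributes f h (Nat.gcd (p j) (p k)) ↔
      i ∈ C.toPCInstance.s j ∧ i ∈ C.toPCInstance.s k := by
    intro i
    change _ ↔ i ∈ attributes f h (p j) ∧ i ∈ attributes f h (p k)
    simp only [attributes, Finset.mem_filter, Finset.mem_univ, true_and, Nat.dvd_gcd_iff]
  unfold PCInstance.Distinguishable
  push Not
  constructor
  · intro H i hi
    obtain ⟨hj, hk⟩ := (hmem i).1 hi
    exact congrArg Fin.val (H i hj hk)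
  · intro H i hj hk
    exact Fin.ext (H i ((hmem i).2 ⟨hj, hk⟩))

end IsDigitCode

/-! ### Start times and schedules -/

namespace WSInstance

variable (P : WSInstance)

theorem exists_ge_of_modEq {p q : ℕ} (hp : 0 < p) (hq : 0 < q) {a b : ℕ}
    (hab : a ≡ b [MOD Nat.gcd p q]) : ∃ k l, a + k * p = b + l * q := by
  obtain ⟨u, hu1, hu2⟩ := Nat.chineseRemainder' hab
  have hw : ∃ w, a ≤ w ∧ b ≤ w ∧ w ≡ a [MOD p] ∧ w ≡ b [MOD q] := by
    -- The solution `u` of the congruences may be smaller than `a` or `b`; adding a multiple of `p *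
    -- q` moves it beyond both starting points.
    refine ⟨u + p * q * (a + b), ?_, ?_, ?_, ?_⟩
    · have : 1 * (a + b) ≤ p * q * (a + b) :=
        Nat.mul_le_mul_right _ (Nat.succ_le_of_lt (Nat.mul_pos hp hq))
      omega
    · have : 1 * (a + b) ≤ p * q * (a + b) :=
        Nat.mul_le_mul_right _ (Nat.succ_le_of_lt (Nat.mul_pos hp hq))
      omega
    · rw [mul_assoc]
      exact (Nat.ModEq.add_right_cancel' 0 (by simp [Nat.ModEq])).trans hu1
    · rw [mul_comm p q, mul_assoc]
      exact (Nat.ModEq.add_right_cancel' 0 (by simp [Nat.ModEq])).trans hu2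
  obtain ⟨w, haw, hbw, h1, h2⟩ := hw
  obtain ⟨k, hk⟩ := (Nat.modEq_iff_dvd' haw).1 h1.symm
  obtain ⟨l, hl⟩ := (Nat.modEq_iff_dvd' hbw).1 h2.symm
  refine ⟨k, l, ?_⟩
  rw [mul_comm k, mul_comm l, ← hk, ← hl]
  omega

theorem collide_iff (t : P.StartTimes) (j k : Fin P.n) :
    P.Collide t j k ↔ (t j : ℕ) ≡ t k [MOD Nat.gcd (P.p j) (P.p k)] := by
  constructor
  · rintro ⟨u, ⟨a, ha⟩, ⟨b, hb⟩⟩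
    have h1 : (t j : ℕ) ≡ u [MOD Nat.gcd (P.p j) (P.p k)] := by
      refine Nat.ModEq.of_dvd (Nat.gcd_dvd_left _ _) ?_
      rw [ha]; simp [Nat.ModEq]
    have h2 : (t k : ℕ) ≡ u [MOD Nat.gcd (P.p j) (P.p k)] := by
      refine Nat.ModEq.of_dvd (Nat.gcd_dvd_right _ _) ?_
      rw [hb]; simp [Nat.ModEq]
    exact h1.trans h2.symm
  · intro h
    obtain ⟨a, b, hab⟩ := exists_ge_of_modEq (P.pos j) (P.pos k) h
    exact ⟨_, ⟨a, rfl⟩, ⟨b, hab⟩⟩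

theorem solvable_of_feasibleStart {t : P.StartTimes} (ht : P.FeasibleStart t) : P.Solvable := by
  classical
  let S : ℕ → Option (Fin P.n) := fun u =>
    if h : ∃ j, u ∈ P.execTimes t j then some h.choose else none
  have hS : ∀ u j, S u = some j ↔ u ∈ P.execTimes t j := by
    intro u j
    constructor
    · intro h
      by_cases hu : ∃ j, u ∈ P.execTimes t j
      · simp only [S, dif_pos hu, Option.some.injEq] at h
        rw [← h]
        exact hu.choose_spec
      · simp [S, dif_neg hu] at h
    · intro h
      have hu : ∃ j, u ∈ P.execTimes t j := ⟨j, h⟩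
      simp only [S, dif_pos hu, Option.some.injEq]
      by_contra hne
      exact ht _ _ hne ⟨u, hu.choose_spec, h⟩
  refine ⟨S, fun j => ⟨fun N => ?_, ?_⟩⟩
  · refine ⟨t j + N * P.p j, ?_, (hS _ _).2 ⟨N, rfl⟩⟩
    have := Nat.le_mul_of_pos_right N (P.pos j)
    omega
  · intro u u' huu hu hu' hbet
    obtain ⟨a, rfl⟩ := (hS _ _).1 hu
    obtain ⟨b, rfl⟩ := (hS _ _).1 hu'
    have hab : a < b := by
      by_contra hcon
      have := Nat.mul_le_mul_right (P.p j) (not_lt.1 hcon)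
      omega
    -- Otherwise execution number `a + 1` would lie strictly between two consecutive ones.
    have hb : b = a + 1 := by
      by_contra hcon
      refine hbet (t j + (a + 1) * P.p j) ?_ ?_ ((hS _ _).2 ⟨a + 1, rfl⟩)
      · have : a * P.p j < (a + 1) * P.p j :=
          Nat.mul_lt_mul_of_pos_right (Nat.lt_succ_self a) (P.pos j)
        omega
      · have := Nat.mul_lt_mul_of_pos_right (show a + 1 < b by omega) (P.pos j)
        omega
    rw [hb, add_mul]; omega

/-- Any one execution `a j` forces executions at all `a j + k * p j`. The start times are the `a j`
reduced modulo the periods; a collision among them would put two jobs into one slot of the schedule.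
-/
theorem exists_feasibleStart_of_solvable (h : P.Solvable) : ∃ t, P.FeasibleStart t := by
  classical
  obtain ⟨S, hS⟩ := h
  choose a _ ha using fun j => (hS j).1 0
  have hper : ∀ j k, S (a j + k * P.p j) = some j := by
    intro j k
    induction k with
    | zero => simpa using ha j
    | succ k ih =>
      have hex : ∃ u, a j + k * P.p j < u ∧ S u = some j := by
        obtain ⟨u, hu, hu'⟩ := (hS j).1 (a j + k * P.p j + 1)
        exact ⟨u, by omega, hu'⟩
      -- The least later execution is the consecutive one, so the gap condition applies to it.
      have h1 := Nat.find_spec hex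
      have h2 := (hS j).2 _ _ h1.1 ih h1.2 fun u hu hu' hcon => Nat.find_min hex hu' ⟨hu, hcon⟩
      have h3 : a j + (k + 1) * P.p j = Nat.find hex := by
        rw [add_mul]; omega
      rw [h3]; exact h1.2
  refine ⟨fun j => ⟨a j % P.p j, Nat.mod_lt _ (P.pos j)⟩, fun j k hjk hcol => hjk ?_⟩
  rw [collide_iff] at hcol
  -- Reduction modulo a period does not change the residue modulo the gcd, which divides the period.
  have h1 : a j ≡ a k [MOD Nat.gcd (P.p j) (P.p k)] := by
    have hj : a j % P.p j ≡ a j [MOD Nat.gcd (P.p j) (P.p k)] :=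
      (Nat.mod_modEq _ _).of_dvd (Nat.gcd_dvd_left _ _)
    have hk : a k % P.p k ≡ a k [MOD Nat.gcd (P.p j) (P.p k)] :=
      (Nat.mod_modEq _ _).of_dvd (Nat.gcd_dvd_right _ _)
    exact hj.symm.trans (hcol.trans hk)
  obtain ⟨x, y, hxy⟩ := exists_ge_of_modEq (P.pos j) (P.pos k) h1
  have h2 := hper j x
  rw [hxy, hper k y] at h2
  exact (Option.some.inj h2).symm

theorem solvable_iff : P.Solvable ↔ ∃ t, P.FeasibleStart t :=
  ⟨P.exists_feasibleStart_of_solvable, fun ⟨_, ht⟩ => P.solvable_of_feasibleStart ht⟩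

end WSInstance

/-! ### Collisions as indistinguishability, and equivalence of the decision problems -/

namespace IsDigitCode

variable {P : WSInstance} {d : ℕ} {V : Finset ℕ} {f h : Fin d → ℕ}

theorem collide_iff (C : IsDigitCode P.p V f h) (t : P.StartTimes) (j k : Fin P.n) :
    P.Collide t j k ↔ ¬ C.toPCInstance.Distinguishable
      (fun l => C.toPCInstance.residueEncoding l (t l : ℕ)) j k := by
  rw [P.collide_iff, C.not_distinguishable_iff (fun l => (t l : ℕ))]

theorem feasibleStart_iff (C : IsDigitCode P.p V f h) (t : P.StartTimes) :
    P.FeasibleStart t ↔ C.toPCInstance.Feasible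
      (fun l => C.toPCInstance.residueEncoding l (t l : ℕ)) :=
  forall₃_congr fun j k _ => by rw [C.collide_iff, not_not]

theorem solvable_iff (C : IsDigitCode P.p V f h) : P.Solvable ↔ C.toPCInstance.Solvable := by
  rw [P.solvable_iff]
  constructor
  · rintro ⟨t, ht⟩
    exact ⟨_, (C.feasibleStart_iff t).1 ht⟩
  · rintro ⟨c, hc⟩
    choose t ht using fun j => (C.residueEncoding_bijective j).2 (c j)
    refine ⟨t, (C.feasibleStart_iff t).2 ?_⟩
    have : (fun l => C.toPCInstance.residueEncoding l (t l : ℕ)) = c := funext ht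
    rw [this]; exact hc

end IsDigitCode

/-! ### gcd splitting -/

/-- What gcd splitting of a multiset `M₀` of positive integers preserves. -/
structure SplitInvariant (M₀ M : Multiset ℕ) : Prop where
  pos : ∀ x ∈ M, 0 < x
  mem_closure : ∀ x ∈ M₀, x ∈ Submonoid.closure {y | y ∈ M}
  dvd : ∀ x ∈ M, ∃ y ∈ M₀, x ∣ y
  prod_le : M.prod * 2 ^ M.card ≤ M₀.prod * 2 ^ M₀.card

theorem SplitInvariant.refl {M : Multiset ℕ} (h : ∀ x ∈ M, 0 < x) : SplitInvariant M M :=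
  ⟨h, fun _ hx => Submonoid.subset_closure hx, fun x hx => ⟨x, hx, dvd_rfl⟩, le_rfl⟩

/-- The old members are `x / g * g` and `y / g * g`, so they stay in the generated monoid. The
product loses a factor `g ≥ 2` and the cardinality grows by one, which gives `prod_le`. -/
theorem SplitInvariant.step {M₀ M M' : Multiset ℕ} (h : SplitInvariant M₀ M)
    (hs : SplitStep M M') : SplitInvariant M₀ M' := by
  obtain ⟨x, y, R, rfl, _, hg1, rfl⟩ := hs
  have hx : 0 < x := h.pos x (by simp)
  have hy : 0 < y := h.pos y (by simp)
  have hg : 0 < Nat.gcd x y := Nat.gcd_pos_of_pos_left _ hx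
  have hgx := Nat.gcd_dvd_left x y
  have hgy := Nat.gcd_dvd_right x y
  set g := Nat.gcd x y with hgdef
  have hxg : x / g * g = x := Nat.div_mul_cancel hgx
  have hyg : y / g * g = y := Nat.div_mul_cancel hgy
  have hx' : 0 < x / g := Nat.div_pos (Nat.le_of_dvd hx hgx) hg
  have hy' : 0 < y / g := Nat.div_pos (Nat.le_of_dvd hy hgy) hg
  refine ⟨?_, ?_, ?_, ?_⟩
  · intro z hz
    simp only [Multiset.mem_cons] at hz
    rcases hz with rfl | rfl | rfl | hz
    · exact hx'
    · exact hg
    · exact hy'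
    · exact h.pos z (by simp [hz])
  · intro z hz
    have hle : Submonoid.closure {w | w ∈ x ::ₘ y ::ₘ R} ≤
        Submonoid.closure {w | w ∈ (x / g) ::ₘ g ::ₘ (y / g) ::ₘ R} := by
      have h1 : x / g * g ∈ Submonoid.closure {w | w ∈ (x / g) ::ₘ g ::ₘ (y / g) ::ₘ R} :=
        mul_mem (Submonoid.subset_closure (by simp)) (Submonoid.subset_closure (by simp))
      have h2 : y / g * g ∈ Submonoid.closure {w | w ∈ (x / g) ::ₘ g ::ₘ (y / g) ::ₘ R} :=
        mul_mem (Submonoid.subset_closure (by simp)) (Submonoid.subset_closure (by simp))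
      rw [hxg] at h1
      rw [hyg] at h2
      rw [Submonoid.closure_le]
      intro w hw
      simp only [Multiset.mem_cons, Set.mem_ofPred_eq] at hw
      rcases hw with hw | hw | hw
      · rw [hw]; exact h1
      · rw [hw]; exact h2
      · exact Submonoid.subset_closure (by simp [hw])
    exact hle (h.mem_closure z hz)
  · intro z hz
    simp only [Multiset.mem_cons] at hz
    obtain ⟨a, ha, hxa⟩ := h.dvd x (by simp)
    obtain ⟨b, hb, hyb⟩ := h.dvd y (by simp)
    rcases hz with rfl | rfl | rfl | hz
    · exact ⟨a, ha, (Nat.div_dvd_of_dvd hgx).trans hxa⟩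
    · exact ⟨a, ha, hgx.trans hxa⟩
    · exact ⟨b, hb, (Nat.div_dvd_of_dvd hgy).trans hyb⟩
    · exact h.dvd z (by simp [hz])
  · refine le_trans ?_ h.prod_le
    simp only [Multiset.prod_cons, Multiset.card_cons]
    have hg2 : 2 ≤ g := by omega
    calc x / g * (g * (y / g * R.prod)) * 2 ^ (R.card + 1 + 1 + 1)
        = (x / g * (y / g * g) * R.prod * 2 ^ (R.card + 1 + 1)) * 2 := by ring
      _ ≤ (x / g * (y / g * g) * R.prod * 2 ^ (R.card + 1 + 1)) * g := Nat.mul_le_mul_left _ hg2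
      _ = (x / g * g) * ((y / g * g) * R.prod) * 2 ^ (R.card + 1 + 1) := by ring
      _ = x * (y * R.prod) * 2 ^ (R.card + 1 + 1) := by rw [hxg, hyg]

theorem SplitInvariant.of_reflTransGen {M₀ M : Multiset ℕ} (h₀ : ∀ x ∈ M₀, 0 < x)
    (h : Relation.ReflTransGen SplitStep M₀ M) : SplitInvariant M₀ M := by
  induction h with
  | refl => exact .refl h₀
  | tail _ hs ih => exact ih.step hs

/-- The multiset of the first `m` entries of an array. -/
def entries (A : ℕ → ℕ) (m : ℕ) : Multiset ℕ :=
  (Multiset.range m).map A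

theorem mem_entries {A : ℕ → ℕ} {m x : ℕ} : x ∈ entries A m ↔ ∃ i < m, A i = x := by
  simp [entries]

theorem card_entries (A : ℕ → ℕ) (m : ℕ) : (entries A m).card = m := by
  simp [entries]

/-- A split in place: the quotients overwrite their sources and the gcd is appended. The two
positions differ because their entries do. -/
theorem splitStep_entries {A : ℕ → ℕ} {m i j : ℕ} (hi : i < m) (hj : j < m) (hne : A i ≠ A j)
    (hg : Nat.gcd (A i) (A j) ≠ 1) :
    SplitStep (entries A m) (entries (Function.update (Function.update (Function.update A i
      (A i / Nat.gcd (A i) (A j))) j (A j / Nat.gcd (A i) (A j))) m (Nat.gcd (A i) (A j)))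
      (m + 1)) := by
  have hij : i ≠ j := fun h => hne (by rw [h])
  have hnd := Multiset.nodup_range m
  have h1 : Multiset.range m = i ::ₘ j ::ₘ ((Multiset.range m).erase i).erase j := by
    rw [Multiset.cons_erase, Multiset.cons_erase]
    · simpa using hi
    · rw [Multiset.mem_erase_of_ne hij.symm]
      simpa using hj
  refine ⟨A i, A j, (((Multiset.range m).erase i).erase j).map A, ?_, hne, hg, ?_⟩
  · conv_lhs => rw [entries, h1]
    simp
  · rw [entries, Multiset.range_succ, h1]
    simp only [Multiset.map_cons]
    rw [← h1]
    have hR : (((Multiset.range m).erase i).erase j).map (Function.update (Function.update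
        (Function.update A i (A i / Nat.gcd (A i) (A j))) j (A j / Nat.gcd (A i) (A j))) m
        (Nat.gcd (A i) (A j))) = (((Multiset.range m).erase i).erase j).map A := by
      refine Multiset.map_congr rfl fun x hx => ?_
      have hx1 := ((hnd.erase i).mem_erase_iff).1 hx
      have hx2 := (hnd.mem_erase_iff).1 hx1.2
      have hx3 := Multiset.mem_range.1 hx2.2
      rw [Function.update_of_ne (by omega), Function.update_of_ne hx1.1,
        Function.update_of_ne hx2.1]
    rw [hR]
    rw [Function.update_self, Function.update_of_ne (by omega : i ≠ m), Function.update_of_ne hij,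
      Function.update_self, Function.update_of_ne (by omega : j ≠ m), Function.update_self]
    rw [Multiset.cons_swap]

theorem not_splitStep_entries {A : ℕ → ℕ} {m : ℕ}
    (h : ∀ i < m, ∀ j < m, A i ≠ A j → Nat.gcd (A i) (A j) = 1) (M : Multiset ℕ) :
    ¬ SplitStep (entries A m) M := by
  rintro ⟨x, y, R, hM, hne, hg, _⟩
  obtain ⟨i, hi, rfl⟩ := mem_entries.1 (show x ∈ entries A m by rw [hM]; simp)
  obtain ⟨j, hj, rfl⟩ := mem_entries.1 (show y ∈ entries A m by rw [hM]; simp)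
  exact hg (h i hi j hj hne)

theorem isCoprimeBase_entries {A : ℕ → ℕ} {m : ℕ} (hpos : ∀ x ∈ entries A m, 0 < x)
    (h : ∀ i < m, ∀ j < m, A i ≠ A j → Nat.gcd (A i) (A j) = 1) :
    IsCoprimeBase ((entries A m).toFinset.erase 1) := by
  constructor
  · intro v hv
    rw [Finset.mem_erase, Multiset.mem_toFinset] at hv
    have := hpos v hv.2
    omega
  · intro u hu v hv huv
    rw [Finset.mem_erase, Multiset.mem_toFinset] at hu hv
    obtain ⟨i, hi, rfl⟩ := mem_entries.1 hu.2
    obtain ⟨j, hj, rfl⟩ := mem_entries.1 hv.2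
    exact h i hi j hj huv

theorem SplitInvariant.mem_closure_erase_one {M₀ M : Multiset ℕ} (h : SplitInvariant M₀ M) {x : ℕ}
    (hx : x ∈ M₀) : x ∈ Submonoid.closure ((M.toFinset.erase 1 : Finset ℕ) : Set ℕ) := by
  refine (Submonoid.closure_le.2 ?_) (h.mem_closure x hx)
  intro y hy
  by_cases hy1 : y = 1
  · subst hy1; exact one_mem _
  · exact Submonoid.subset_closure (by simpa [hy1] using hy)

/-! ### Reasoning about programs -/

namespace RAM

@[simp] theorem State.reg_setReg (σ : State) (x v y : ℕ) :
    (σ.setReg x v).reg y = if y = x then v else σ.reg y := by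
  simp [State.setReg, Function.update_apply]

@[simp] theorem State.arr_setReg (σ : State) (x v : ℕ) : (σ.setReg x v).arr = σ.arr := rfl

@[simp] theorem State.reg_setCell (σ : State) (a i v : ℕ) : (σ.setCell a i v).reg = σ.reg := rfl

@[simp] theorem State.arr_setCell_self (σ : State) (a i v : ℕ) :
    (σ.setCell a i v).arr a = Function.update (σ.arr a) i v := by
  simp [State.setCell]

@[simp] theorem State.arr_setCell_of_ne (σ : State) {a b : ℕ} (i v : ℕ) (h : b ≠ a) :
    (σ.setCell a i v).arr b = σ.arr b := by
  simp [State.setCell, h]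

/-- All numbers in memory have at most `W` bits. -/
def State.Bounded (W : ℕ) (σ : State) : Prop :=
  (∀ x, σ.reg x < 2 ^ W) ∧ ∀ a i, σ.arr a i < 2 ^ W

theorem State.Bounded.setReg {W : ℕ} {σ : State} (h : σ.Bounded W) (x : ℕ) {v : ℕ}
    (hv : v < 2 ^ W) : (σ.setReg x v).Bounded W := by
  refine ⟨fun y => ?_, h.2⟩
  rw [State.reg_setReg]
  split
  · exact hv
  · exact h.1 y

theorem State.Bounded.setCell {W : ℕ} {σ : State} (h : σ.Bounded W) (a i : ℕ) {v : ℕ}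
    (hv : v < 2 ^ W) : (σ.setCell a i v).Bounded W := by
  refine ⟨h.1, fun b k => ?_⟩
  by_cases hb : b = a
  · subst hb
    rw [State.arr_setCell_self, Function.update_apply]
    split
    · exact hv
    · exact h.2 b k
  · rw [State.arr_setCell_of_ne _ _ _ hb]
    exact h.2 b k

/-- Started in `σ`, if `σ` is bounded by words of `W` bits, the program `p` halts within `k`
instructions and tests, keeps to words of `W` bits, and establishes `Q`. -/
def Within (W : ℕ) (p : Prog) (σ : State) (k : ℕ) (Q : State → Prop) : Prop :=
  σ.Bounded W → ∃ c τ, Exec p σ c τ ∧ c ≤ k * (3 * W + 1) ∧ τ.Bounded W ∧ Q τ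

namespace Within

variable {W k k₁ k₂ : ℕ} {p q : Prog} {σ : State} {Q Q' : State → Prop}

theorem mono (h : Within W p σ k₁ Q') (hk : k₁ ≤ k) (hQ : ∀ τ, Q' τ → Q τ) : Within W p σ k Q := by
  intro hσ
  obtain ⟨c, τ, h1, h2, h3, h4⟩ := h hσ
  exact ⟨c, τ, h1, h2.trans (Nat.mul_le_mul_right _ hk), h3, hQ τ h4⟩

theorem of_bounded (h : σ.Bounded W → Within W p σ k Q) : Within W p σ k Q :=
  fun hσ => h hσ hσ

theorem skip (h : Q σ) : Within W .skip σ (k + 1) Q := fun hσ =>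
  ⟨1, σ, .skip σ, by nlinarith, hσ, h⟩

theorem const {x v : ℕ} (hv : v < 2 ^ W) (h : Q (σ.setReg x v)) :
    Within W (.const x v) σ (k + 1) Q := by
  intro hσ
  refine ⟨_, _, .const σ x v, ?_, hσ.setReg x hv, h⟩
  have := Nat.size_le.2 hv
  nlinarith

/-- An instruction handles at most three numbers of at most `W` bits, which is the origin of the
factor `3 * W + 1`. The budget `k + 1` leaves slack, so that it fits any positive bound. -/
theorem arith {op : Op} {x y z : ℕ} (hv : op.eval (σ.reg y) (σ.reg z) < 2 ^ W)
    (h : Q (σ.setReg x (op.eval (σ.reg y) (σ.reg z)))) :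
    Within W (.arith op x y z) σ (k + 1) Q := by
  intro hσ
  refine ⟨_, _, .arith σ op x y z, ?_, hσ.setReg x hv, h⟩
  have h1 := Nat.size_le.2 hv
  have h2 := Nat.size_le.2 (hσ.1 y)
  have h3 := Nat.size_le.2 (hσ.1 z)
  nlinarith

theorem add {x y z : ℕ} (hv : σ.reg y + σ.reg z < 2 ^ W)
    (h : Q (σ.setReg x (σ.reg y + σ.reg z))) : Within W (.arith .add x y z) σ (k + 1) Q :=
  arith (op := .add) hv h

theorem mul {x y z : ℕ} (hv : σ.reg y * σ.reg z < 2 ^ W)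
    (h : Q (σ.setReg x (σ.reg y * σ.reg z))) : Within W (.arith .mul x y z) σ (k + 1) Q :=
  arith (op := .mul) hv h

theorem sub {x y z : ℕ} (h : Q (σ.setReg x (σ.reg y - σ.reg z))) :
    Within W (.arith .sub x y z) σ (k + 1) Q :=
  of_bounded fun hσ => arith (op := .sub) ((Nat.sub_le _ _).trans_lt (hσ.1 y)) h

theorem div {x y z : ℕ} (h : Q (σ.setReg x (σ.reg y / σ.reg z))) :
    Within W (.arith .div x y z) σ (k + 1) Q :=
  of_bounded fun hσ => arith (op := .div) ((Nat.div_le_self _ _).trans_lt (hσ.1 y)) h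

theorem load {x a y : ℕ} (h : Q (σ.setReg x (σ.arr a (σ.reg y)))) :
    Within W (.load x a y) σ (k + 1) Q := by
  intro hσ
  refine ⟨_, _, .load σ x a y, ?_, hσ.setReg x (hσ.2 _ _), h⟩
  have h1 := Nat.size_le.2 (hσ.2 a (σ.reg y))
  have h2 := Nat.size_le.2 (hσ.1 y)
  nlinarith

theorem store {a y x : ℕ} (h : Q (σ.setCell a (σ.reg y) (σ.reg x))) :
    Within W (.store a y x) σ (k + 1) Q := by
  intro hσ
  refine ⟨_, _, .store σ a y x, ?_, hσ.setCell a _ (hσ.1 x), h⟩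
  have h1 := Nat.size_le.2 (hσ.1 x)
  have h2 := Nat.size_le.2 (hσ.1 y)
  nlinarith

/-- The specification of `q` is the postcondition of `p`, so no intermediate assertion has to be
named. -/
theorem seq (hk : k₁ + k₂ ≤ k) (h : Within W p σ k₁ fun τ => Within W q τ k₂ Q) :
    Within W (.seq p q) σ k Q := by
  intro hσ
  obtain ⟨c, τ, h1, h2, h3, h4⟩ := h hσ
  obtain ⟨c', ρ, h5, h6, h7, h8⟩ := h4 h3
  refine ⟨_, ρ, .seq h1 h5, ?_, h7, h8⟩
  calc c + c' ≤ k₁ * (3 * W + 1) + k₂ * (3 * W + 1) := Nat.add_le_add h2 h6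
    _ = (k₁ + k₂) * (3 * W + 1) := by ring
    _ ≤ _ := Nat.mul_le_mul_right _ hk

/-- Sequential composition whose first part is one instruction. -/
theorem seq' (h : Within W p σ 1 fun τ => Within W q τ k Q) : Within W (.seq p q) σ (k + 1) Q :=
  seq (k₁ := 1) (by omega) h

theorem ite {x : ℕ} (h₁ : σ.reg x ≠ 0 → Within W p σ k Q) (h₂ : σ.reg x = 0 → Within W q σ k Q) :
    Within W (.ite x p q) σ (k + 1) Q := by
  intro hσ
  have hsz := Nat.size_le.2 (hσ.1 x)
  by_cases hx : σ.reg x = 0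
  · obtain ⟨c, τ, h1, h2, h3, h4⟩ := h₂ hx hσ
    exact ⟨_, τ, .iteFalse hx h1, by nlinarith, h3, h4⟩
  · obtain ⟨c, τ, h1, h2, h3, h4⟩ := h₁ hx hσ
    exact ⟨_, τ, .iteTrue hx h1, by nlinarith, h3, h4⟩

/-- A loop whose body preserves the invariant `I` and decreases its parameter. -/
theorem loop {x a : ℕ} (I : ℕ → State → Prop)
    (hbody : ∀ a σ, I a σ → σ.reg x ≠ 0 → Within W p σ k fun τ => ∃ b < a, I b τ) (hI : I a σ) :
    Within W (.loop x p) σ (a * (k + 1) + 1) fun τ => ∃ b, I b τ ∧ τ.reg x = 0 := by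
  intro hσ
  induction a using Nat.strong_induction_on generalizing σ with
  | _ a ih =>
    have hsz := Nat.size_le.2 (hσ.1 x)
    by_cases hx : σ.reg x = 0
    · refine ⟨_, σ, .loopStop hx, ?_, hσ, a, hI, hx⟩
      calc 1 + (σ.reg x).size ≤ 1 * (3 * W + 1) := by omega
        _ ≤ _ := Nat.mul_le_mul_right _ (by omega)
    · obtain ⟨c, τ, h1, h2, h3, b, hb, h4⟩ := hbody a σ hI hx hσ
      obtain ⟨c', ρ, h6, h7, h8, h9⟩ := ih b hb h4 h3
      refine ⟨_, ρ, .loopStep hx h1 h6, ?_, h8, h9⟩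
      have h10 : (b + 1) * (k + 1) ≤ a * (k + 1) := Nat.mul_le_mul_right _ hb
      calc 1 + (σ.reg x).size + c + c'
          ≤ 1 * (3 * W + 1) + k * (3 * W + 1) + (b * (k + 1) + 1) * (3 * W + 1) := by omega
        _ = ((b + 1) * (k + 1) + 1) * (3 * W + 1) := by ring
        _ ≤ _ := Nat.mul_le_mul_right _ (by omega)

end Within

/-- `x := x + 1`; register `1` is used for the constant. -/
def incr (x : ℕ) : Prog :=
  .seq (.const 1 1) (.arith .add x x 1)

/-- `x := y` for different registers. -/
def move (x y : ℕ) : Prog :=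
  .seq (.const x 0) (.arith .add x x y)

/-- `x := y mod z` for a register `x` different from `y` and `z`. -/
def modulo (x y z : ℕ) : Prog :=
  .seq (.arith .div x y z) (.seq (.arith .mul x x z) (.arith .sub x y x))

/-- Run `p` for `i = 0, …, n - 1`, where register `n` holds the bound; register `12` is used for
the test. -/
def forLoop (i n : ℕ) (p : Prog) : Prog :=
  .seq (.const i 0) (.seq (.arith .sub 12 n i)
    (.loop 12 (.seq p (.seq (incr i) (.arith .sub 12 n i)))))

theorem State.setReg_setReg (σ : State) (x v w : ℕ) :
    (σ.setReg x v).setReg x w = σ.setReg x w := by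
  simp [State.setReg]

namespace Within

variable {W k k₁ k₂ : ℕ} {p q : Prog} {σ : State} {Q Q' : State → Prop}

theorem incr {x : ℕ} (hx : x ≠ 1) (hv : σ.reg x + 1 < 2 ^ W)
    (h : Q ((σ.setReg 1 1).setReg x (σ.reg x + 1))) : Within W (incr x) σ (k + 2) Q := by
  refine seq' (const (by omega) (add ?_ ?_))
  · simpa [hx] using hv
  · simpa [hx] using h

theorem move {x y : ℕ} (hxy : x ≠ y) (h : Q (σ.setReg x (σ.reg y))) :
    Within W (move x y) σ (k + 2) Q := by
  refine of_bounded fun hσ => seq' (const (by positivity) (add ?_ ?_))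
  · simpa [hxy.symm] using hσ.1 y
  · simpa [hxy.symm, State.setReg_setReg] using h

theorem modulo {x y z : ℕ} (hy : x ≠ y) (hz : x ≠ z) (h : Q (σ.setReg x (σ.reg y % σ.reg z))) :
    Within W (modulo x y z) σ (k + 3) Q := by
  refine of_bounded fun hσ => seq' (div (seq' (mul ?_ (sub ?_))))
  · simp only [State.reg_setReg, if_neg hz.symm, if_true]
    exact (Nat.div_mul_le_self _ _).trans_lt (hσ.1 y)
  · simp only [State.reg_setReg, if_neg hz.symm, if_neg hy.symm, if_true, State.setReg_setReg]
    have : σ.reg y - σ.reg y / σ.reg z * σ.reg z = σ.reg y % σ.reg z := by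
      have := Nat.div_add_mod' (σ.reg y) (σ.reg z)
      omega
    rwa [this]

/-- The rule for `forLoop`: the invariant `I i` holds before round `i`. -/
theorem forLoop {i n N : ℕ} (I : ℕ → State → Prop) (hin : i ≠ n) (hi1 : i ≠ 1) (hn1 : n ≠ 1)
    (hi12 : i ≠ 12) (hn12 : n ≠ 12) (hN : σ.reg n = N)
    (h₀ : ∀ v, I 0 ((σ.setReg i 0).setReg 12 v))
    (hbody : ∀ j < N, ∀ σ, I j σ → σ.reg i = j → σ.reg n = N →
      Within W p σ k fun τ => τ.reg i = j ∧ τ.reg n = N ∧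
        ∀ v, I (j + 1) (((τ.setReg 1 1).setReg i (j + 1)).setReg 12 v)) :
    Within W (forLoop i n p) σ (N * (k + 4) + 3) fun τ => I N τ ∧ τ.reg n = N := by
  refine of_bounded fun hσ => ?_
  have hNB : N < 2 ^ W := hN ▸ hσ.1 n
  refine seq' (const (by positivity) (seq' (sub ?_)))
  -- The loop parameter is the number of remaining rounds, which is the content of register `12`. A
  -- round costs the body, three instructions and one test.
  refine (loop (k := k + 3) (a := N) (fun a τ => ∃ j, j + a = N ∧ I j τ ∧ τ.reg i = j ∧
    τ.reg n = N ∧ τ.reg 12 = a) ?_ ?_).mono ?_ ?_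
  · rintro a τ ⟨j, hj, h1, h2, h3, h4⟩ h5
    have hjN : j < N := by omega
    refine seq (k₁ := k) (k₂ := 3) le_rfl ((hbody j hjN τ h1 h2 h3).mono le_rfl ?_)
    rintro ρ ⟨h6, h7, h8⟩
    refine seq (k₁ := 2) (k₂ := 1) le_rfl (incr hi1 (by omega) (sub ?_))
    refine ⟨N - (j + 1), by omega, j + 1, by omega, ?_, ?_, ?_, ?_⟩
    · rw [h6]; exact h8 _
    · simp [hi12, h6]
    · simp [hn12, hin.symm, hn1, h7]
    · simp [hin.symm, hn1, h6, h7]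
  · refine ⟨0, by omega, h₀ _, ?_, ?_, ?_⟩
    · simp [hi12]
    · simp [hn12, hin.symm, hN]
    · simp [hin.symm, hN]
  · exact le_rfl
  · rintro τ ⟨a, ⟨j, hj, h1, h2, h3, h4⟩, h5⟩
    have : j = N := by omega
    subst this
    exact ⟨h1, h3⟩

end Within

/-- The two states differ only in the registers of the list. -/
def State.EqOff (S : List ℕ) (σ τ : State) : Prop :=
  (∀ x, x ∉ S → τ.reg x = σ.reg x) ∧ τ.arr = σ.arr

theorem State.EqOff.refl (S : List ℕ) (σ : State) : State.EqOff S σ σ :=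
  ⟨fun _ _ => rfl, rfl⟩

theorem State.EqOff.setReg {S : List ℕ} {σ τ : State} (h : State.EqOff S σ τ) {x : ℕ} (hx : x ∈ S)
    (v : ℕ) : State.EqOff S σ (τ.setReg x v) := by
  refine ⟨fun y hy => ?_, h.2⟩
  rw [State.reg_setReg, if_neg (by rintro rfl; exact hy hx)]
  exact h.1 y hy

end RAM

/-! ### Subroutines -/

namespace RAM

infixr:67 " ;; " => Prog.seq

/-- Copy the input to the arrays `1` and `2`, and its length to the registers `2` and `3`. -/
def copyProg : Prog :=
  move 2 0 ;; move 3 2 ;; forLoop 4 2 (.load 10 0 4 ;; .store 1 4 10 ;; .store 2 4 10)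

/-- Euclid's algorithm on the registers `7` and `8`, with the result in register `7`. -/
def gcdProg : Prog :=
  .loop 8 (modulo 9 7 8 ;; move 7 8 ;; move 8 9)

/-- Set register `16` to a nonzero number if the number in register `14` divides an entry of
array `1`, and to `0` otherwise. -/
def anyDvdProg : Prog :=
  .const 16 0 ;; forLoop 4 2 (.load 10 1 4 ;; modulo 9 10 14 ;; .ite 9 .skip (.const 16 1))

/-- Set register `16` to the smallest entry of array `2` that exceeds register `13`, and to `0` if
there is none. -/
def nextProg : Prog :=
  .const 16 0 ;; forLoop 4 3 (.load 10 2 4 ;; .arith .sub 9 10 13 ;;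
    .ite 9 (.ite 16 (.arith .sub 9 16 10 ;; .ite 9 (move 16 10) .skip) (move 16 10)) .skip)

namespace Within

variable {W : ℕ} {σ : State}

theorem copyProg {n : ℕ} (hn : σ.reg 0 = n) :
    Within W copyProg σ (n * 7 + 7) fun τ => τ.reg 2 = n ∧ τ.reg 3 = n ∧
      (∀ j < n, τ.arr 1 j = σ.arr 0 j) ∧ ∀ j < n, τ.arr 2 j = σ.arr 0 j := by
  refine seq (k₁ := 2) (k₂ := n * 7 + 5) (by omega) (move (by decide) ?_)
  refine seq (k₁ := 2) (k₂ := n * 7 + 3) (by omega) (move (by decide) ?_)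
  refine (forLoop (k := 3) (N := n) (fun i τ => τ.reg 2 = n ∧ τ.reg 3 = n ∧ τ.arr 0 = σ.arr 0 ∧
      (∀ j < i, τ.arr 1 j = σ.arr 0 j) ∧ ∀ j < i, τ.arr 2 j = σ.arr 0 j)
      (by decide) (by decide) (by decide) (by decide) (by decide) (by simp [hn]) ?_ ?_).mono
      (by omega) fun τ h => ⟨h.1.1, h.1.2.1, h.1.2.2.2⟩
  · intro v
    simp [hn]
  · rintro j hj τ ⟨h2, h3, h4, h5, h6⟩ h7 _
    refine seq' (load (seq' (store (store ?_))))
    refine ⟨by simp [h7], by simp [h2], fun v => ⟨by simp [h2], by simp [h3], by simp [h4], ?_, ?_⟩⟩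
    · intro i hi
      simp only [State.arr_setReg, State.arr_setCell_self, State.reg_setReg, State.reg_setCell,
        ne_eq, OfNat.one_ne_ofNat, not_false_eq_true, State.arr_setCell_of_ne, h7, h4]
      rcases Nat.lt_succ_iff_lt_or_eq.1 hi with hi | rfl
      · simp [Function.update_of_ne hi.ne, h5 i hi]
      · simp
    · intro i hi
      simp only [State.arr_setReg, State.arr_setCell_self, State.reg_setReg, State.reg_setCell,
        ne_eq, OfNat.ofNat_ne_one, not_false_eq_true, State.arr_setCell_of_ne, h7, h4]
      rcases Nat.lt_succ_iff_lt_or_eq.1 hi with hi | rfl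
      · simp [Function.update_of_ne hi.ne, h6 i hi]
      · simp

/-- For `b ≤ a` the remainder is at most `a / 2`, so it loses a bit. -/
theorem size_mod_lt {a b : ℕ} (hb : 0 < b) (hab : b ≤ a) : (a % b).size < a.size := by
  have h1 : 2 * (a % b) ≤ a := by
    have h2 := Nat.mod_lt a hb
    have h3 := Nat.div_add_mod a b
    have h4 : 1 ≤ a / b := Nat.div_pos hab hb
    have h5 : b * 1 ≤ b * (a / b) := Nat.mul_le_mul_left _ h4
    omega
  have h2 : 0 < a.size := Nat.size_pos.2 (by omega)
  have h3 : a < 2 ^ a.size := Nat.lt_size_self a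
  have h4 : a % b < 2 ^ (a.size - 1) := by
    have h5 : 2 ^ a.size = 2 * 2 ^ (a.size - 1) := by
      rw [← pow_succ']; congr 1; omega
    omega
  have := Nat.size_le.2 h4
  omega

theorem gcdProg : Within W gcdProg σ ((2 * W + 1) * 8 + 1) fun τ =>
    State.EqOff [7, 8, 9] σ τ ∧ τ.reg 7 = Nat.gcd (σ.reg 7) (σ.reg 8) := by
  refine of_bounded fun hσ => ?_
  have h7 := Nat.size_le.2 (hσ.1 7)
  have h8 := Nat.size_le.2 (hσ.1 8)
  -- The measure is the total bit length, plus 1 if the registers are in the wrong order. A round in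
  -- the wrong order only swaps them and uses up this 1; every other round loses a bit. In total at
  -- most `2 * W + 1` rounds.
  refine (loop (k := 7) (a := (σ.reg 7).size + (σ.reg 8).size +
    if σ.reg 7 < σ.reg 8 then 1 else 0) (fun a τ => State.EqOff [7, 8, 9] σ τ ∧
    Nat.gcd (τ.reg 7) (τ.reg 8) = Nat.gcd (σ.reg 7) (σ.reg 8) ∧
    a = (τ.reg 7).size + (τ.reg 8).size + if τ.reg 7 < τ.reg 8 then 1 else 0) ?_ ?_).mono ?_ ?_
  · rintro a τ ⟨h1, h2, rfl⟩ h3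
    refine seq (k₁ := 3) (k₂ := 4) le_rfl (modulo (by decide) (by decide) ?_)
    refine seq (k₁ := 2) (k₂ := 2) le_rfl (move (by decide) (move (by decide) ?_))
    refine ⟨_, ?_, ((h1.setReg (by decide) _).setReg (by decide) _).setReg (by decide) _, ?_, rfl⟩
    · have h4 : τ.reg 7 % τ.reg 8 < τ.reg 8 := Nat.mod_lt _ (by omega)
      simp only [State.reg_setReg]
      norm_num
      rw [if_neg (not_lt.2 h4.le)]
      by_cases h5 : τ.reg 7 < τ.reg 8
      · rw [if_pos h5, Nat.mod_eq_of_lt h5]; omega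
      · rw [if_neg h5]
        have := size_mod_lt (Nat.pos_of_ne_zero h3) (not_lt.1 h5)
        omega
    · rw [← h2]
      simp
      rw [Nat.gcd_comm, ← Nat.gcd_rec, Nat.gcd_comm]
  · exact ⟨State.EqOff.refl _ _, rfl, rfl⟩
  · refine Nat.succ_le_succ (Nat.mul_le_mul_right _ ?_)
    split <;> omega
  · rintro τ ⟨a, ⟨h1, h2, -⟩, h3⟩
    refine ⟨h1, ?_⟩
    rw [← h2, h3, Nat.gcd_zero_right]

theorem anyDvdProg {n : ℕ} (hW : 0 < W) (hn : σ.reg 2 = n) :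
    Within W anyDvdProg σ (n * 10 + 4) fun τ => State.EqOff [1, 4, 9, 10, 12, 16] σ τ ∧
      (τ.reg 16 ≠ 0 ↔ ∃ j < n, σ.reg 14 ∣ σ.arr 1 j) := by
  refine seq' (const (by positivity) ?_)
  refine (forLoop (k := 6) (N := n) (fun i τ => State.EqOff [1, 4, 9, 10, 12, 16] σ τ ∧
      (τ.reg 16 ≠ 0 ↔ ∃ j < i, σ.reg 14 ∣ σ.arr 1 j))
      (by decide) (by decide) (by decide) (by decide) (by decide) (by simp [hn]) ?_ ?_).mono
      (by omega) fun τ h => h.1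
  · intro v
    refine ⟨(((State.EqOff.refl _ _).setReg (by decide) _).setReg (by decide) _).setReg
      (by decide) _, ?_⟩
    simp
  · rintro j hj τ ⟨h1, h2⟩ h3 h4
    have h5 : τ.reg 14 = σ.reg 14 := h1.1 14 (by decide)
    refine seq' (load ?_)
    refine seq (k₁ := 3) (k₂ := 2) le_rfl (modulo (by decide) (by decide) (ite ?_ ?_))
    · intro h6
      simp only [State.reg_setReg] at h6
      norm_num [h5, h3, h1.2] at h6
      refine skip ⟨by simp [h3], by simp [h4], fun v => ⟨((((h1.setReg ?_ _).setReg ?_ _).setReg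
        ?_ _).setReg ?_ _).setReg ?_ _, ?_⟩⟩
      all_goals try decide
      simp only [State.reg_setReg]
      norm_num
      rw [← ne_eq, h2]
      constructor
      · rintro ⟨i, hi, hd⟩; exact ⟨i, hi.le, hd⟩
      · rintro ⟨i, hi, hd⟩
        rcases hi.lt_or_eq with hi | rfl
        · exact ⟨i, hi, hd⟩
        · exact absurd (Nat.mod_eq_zero_of_dvd hd) h6
    · intro h6
      simp only [State.reg_setReg] at h6
      norm_num [h5, h3, h1.2] at h6
      refine const (Nat.one_lt_two_pow hW.ne') ⟨by simp [h3], by simp [h4], fun v =>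
        ⟨(((((h1.setReg ?_ _).setReg ?_ _).setReg ?_ _).setReg ?_ _).setReg ?_ _).setReg ?_ _, ?_⟩⟩
      all_goals try decide
      simp only [State.reg_setReg]
      norm_num
      exact ⟨j, le_rfl, Nat.dvd_of_mod_eq_zero h6⟩

theorem nextProg {m : ℕ} (hm : σ.reg 3 = m) :
    Within W nextProg σ (m * 12 + 4) fun τ => State.EqOff [1, 4, 9, 10, 12, 16] σ τ ∧
      ((τ.reg 16 = 0 ∧ ∀ i < m, σ.arr 2 i ≤ σ.reg 13) ∨
        ((∃ i < m, σ.arr 2 i = τ.reg 16) ∧ σ.reg 13 < τ.reg 16 ∧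
          ∀ i < m, σ.reg 13 < σ.arr 2 i → τ.reg 16 ≤ σ.arr 2 i)) := by
  refine seq' (const (by positivity) ?_)
  refine (forLoop (k := 8) (N := m) (fun l τ => State.EqOff [1, 4, 9, 10, 12, 16] σ τ ∧
      ((τ.reg 16 = 0 ∧ ∀ i < l, σ.arr 2 i ≤ σ.reg 13) ∨
        ((∃ i < l, σ.arr 2 i = τ.reg 16) ∧ σ.reg 13 < τ.reg 16 ∧
          ∀ i < l, σ.reg 13 < σ.arr 2 i → τ.reg 16 ≤ σ.arr 2 i)))
      (by decide) (by decide) (by decide) (by decide) (by decide) (by simp [hm]) ?_ ?_).mono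
      (by omega) fun τ h => h.1
  · intro v
    refine ⟨(((State.EqOff.refl _ _).setReg (by decide) _).setReg (by decide) _).setReg
      (by decide) _, ?_⟩
    simp
  · rintro j hj τ ⟨h1, h2⟩ h3 h4
    have h5 : τ.reg 13 = σ.reg 13 := h1.1 13 (by decide)
    -- The new content `b` of register `16` has three possible origins: still no candidate (marked
    -- by `0`), the old candidate, or the current entry.
    have key : ∀ b, ((b = 0 ∧ τ.reg 16 = 0 ∧ σ.arr 2 j ≤ σ.reg 13) ∨
        (b = τ.reg 16 ∧ b ≠ 0 ∧ (σ.reg 13 < σ.arr 2 j → b ≤ σ.arr 2 j)) ∨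
        (b = σ.arr 2 j ∧ σ.reg 13 < b ∧ (τ.reg 16 ≠ 0 → b ≤ τ.reg 16))) →
        ((b = 0 ∧ ∀ i < j + 1, σ.arr 2 i ≤ σ.reg 13) ∨
        ((∃ i < j + 1, σ.arr 2 i = b) ∧ σ.reg 13 < b ∧
          ∀ i < j + 1, σ.reg 13 < σ.arr 2 i → b ≤ σ.arr 2 i)) := by
      rintro b (⟨rfl, hb, hle⟩ | ⟨rfl, hb, hle⟩ | ⟨rfl, hlt, hle⟩)
      · rcases h2 with ⟨-, h2⟩ | ⟨-, h2, -⟩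
        · refine Or.inl ⟨rfl, fun i hi => ?_⟩
          rcases Nat.lt_succ_iff_lt_or_eq.1 hi with hi | rfl
          · exact h2 i hi
          · exact hle
        · omega
      · rcases h2 with ⟨h2, -⟩ | ⟨⟨i, hi, h6⟩, h7, h8⟩
        · exact absurd h2 hb
        · refine Or.inr ⟨⟨i, by omega, h6⟩, h7, fun i hi => ?_⟩
          rcases Nat.lt_succ_iff_lt_or_eq.1 hi with hi | rfl
          · exact h8 i hi
          · exact hle
      · refine Or.inr ⟨⟨j, by omega, rfl⟩, hlt, fun i hi hi' => ?_⟩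
        rcases Nat.lt_succ_iff_lt_or_eq.1 hi with hi | rfl
        · rcases h2 with ⟨-, h2⟩ | ⟨-, h6, h7⟩
          · exact absurd (h2 i hi) (not_le.2 hi')
          · exact (hle (by omega)).trans (h7 i hi hi')
        · exact le_rfl
    have fin : ∀ ρ : State, State.EqOff [1, 4, 9, 10, 12, 16] σ ρ → ρ.reg 4 = j → ρ.reg 3 = m →
        ((ρ.reg 16 = 0 ∧ τ.reg 16 = 0 ∧ σ.arr 2 j ≤ σ.reg 13) ∨
        (ρ.reg 16 = τ.reg 16 ∧ ρ.reg 16 ≠ 0 ∧ (σ.reg 13 < σ.arr 2 j → ρ.reg 16 ≤ σ.arr 2 j)) ∨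
        (ρ.reg 16 = σ.arr 2 j ∧ σ.reg 13 < ρ.reg 16 ∧ (τ.reg 16 ≠ 0 → ρ.reg 16 ≤ τ.reg 16))) →
        ρ.reg 4 = j ∧ ρ.reg 3 = m ∧ ∀ v, (fun l τ => State.EqOff [1, 4, 9, 10, 12, 16] σ τ ∧
      ((τ.reg 16 = 0 ∧ ∀ i < l, σ.arr 2 i ≤ σ.reg 13) ∨
        ((∃ i < l, σ.arr 2 i = τ.reg 16) ∧ σ.reg 13 < τ.reg 16 ∧
          ∀ i < l, σ.reg 13 < σ.arr 2 i → τ.reg 16 ≤ σ.arr 2 i))) (j + 1)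
          (((ρ.setReg 1 1).setReg 4 (j + 1)).setReg 12 v) := by
      intro ρ h6 h7 h8 h9
      refine ⟨h7, h8, fun v => ⟨((h6.setReg (by decide) _).setReg (by decide) _).setReg
        (by decide) _, ?_⟩⟩
      simpa using key _ h9
    have e10 : State.EqOff [1, 4, 9, 10, 12, 16] σ ((τ.setReg 10 (τ.arr 2 (τ.reg 4))).setReg 9
        (σ.arr 2 j - σ.reg 13)) := (h1.setReg (by decide) _).setReg (by decide) _
    refine seq' (load (seq' (sub ?_)))
    simp only [State.reg_setReg, h1.2, h3, h5, if_true, if_false,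
      show ¬ (13 : ℕ) = 10 by decide] at e10 ⊢
    refine ite (fun h6 => ite (fun h7 => ?_) fun h7 => ?_) fun h6 => ?_
    · refine seq' (sub (ite (fun h8 => move (by decide) ?_) fun h8 => skip ?_))
      · simp at h6 h7 h8
        refine fin _ ((e10.setReg (by decide) _).setReg (by decide) _) (by simp [h3])
          (by simp [h4]) (Or.inr (Or.inr ?_))
        simp
        omega
      · simp at h6 h7 h8
        refine fin _ (e10.setReg (by decide) _) (by simp [h3])
          (by simp [h4]) (Or.inr (Or.inl ?_))
        simp
        omega
    · refine move (by decide) ?_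
      simp at h6 h7
      refine fin _ (e10.setReg (by decide) _) (by simp [h3])
          (by simp [h4]) (Or.inr (Or.inr ?_))
      simp
      omega
    · refine skip ?_
      simp at h6
      refine fin _ e10 (by simp [h3]) (by simp [h4]) ?_
      simp
      omega

end Within

end RAM

/-! ### The program for gcd splitting -/

namespace RAM

/-- Positive entries `p 0, …, p (n - 1)` of total length at most `L`. -/
structure SizeBound (n : ℕ) (p : ℕ → ℕ) (L : ℕ) : Prop where
  pos : ∀ j < n, 0 < p j
  lt : ∀ j < n, p j < 2 ^ L
  prod_le : (entries p n).prod ≤ 2 ^ L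
  le : n ≤ L

/-- Addresses and counters stay at most cubic in `L`, so they fit into the words of `4 * L + 8` bits
used throughout. -/
theorem cube_lt (L : ℕ) : 8 * (L + 1) ^ 3 < 2 ^ (4 * L + 8) := by
  have h1 : L + 1 ≤ 2 ^ L := Nat.lt_two_pow_self
  have h2 : (L + 1) ^ 3 ≤ (2 ^ L) ^ 3 := Nat.pow_le_pow_left h1 3
  rw [← pow_mul] at h2
  calc 8 * (L + 1) ^ 3 ≤ 2 ^ 3 * 2 ^ (L * 3) := Nat.mul_le_mul (by norm_num) h2
    _ = 2 ^ (3 + L * 3) := (pow_add _ _ _).symm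
    _ < 2 ^ (4 * L + 8) := Nat.pow_lt_pow_right (by norm_num) (by omega)

theorem mul_lt_two_pow {L a b : ℕ} (ha : a < 2 ^ L) (hb : b < 2 ^ L) :
    a * b < 2 ^ (4 * L + 8) := by
  calc a * b ≤ 2 ^ L * 2 ^ L := Nat.mul_le_mul ha.le hb.le
    _ = 2 ^ (L + L) := (pow_add _ _ _).symm
    _ < 2 ^ (4 * L + 8) := Nat.pow_lt_pow_right (by norm_num) (by omega)

namespace SizeBound

variable {n L : ℕ} {p : ℕ → ℕ}

theorem splitInvariant (B : SizeBound n p L) {M : Multiset ℕ}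
    (h : Relation.ReflTransGen SplitStep (entries p n) M) : SplitInvariant (entries p n) M := by
  refine .of_reflTransGen (fun x hx => ?_) h
  obtain ⟨i, hi, rfl⟩ := mem_entries.1 hx
  exact B.pos i hi

theorem lt_of_mem (B : SizeBound n p L) {M : Multiset ℕ}
    (h : Relation.ReflTransGen SplitStep (entries p n) M) {x : ℕ} (hx : x ∈ M) : x < 2 ^ L := by
  obtain ⟨y, hy, hxy⟩ := (B.splitInvariant h).dvd x hx
  obtain ⟨i, hi, rfl⟩ := mem_entries.1 hy
  exact (Nat.le_of_dvd (B.pos i hi) hxy).trans_lt (B.lt i hi)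

/-- The potential starts at no more than `2 ^ L * 2 ^ n`, and the product stays positive; hence
`M.card ≤ L + n ≤ 2 * L`. -/
theorem card_le (B : SizeBound n p L) {M : Multiset ℕ}
    (h : Relation.ReflTransGen SplitStep (entries p n) M) : M.card ≤ 2 * L := by
  have h1 := B.splitInvariant h
  have h2 : 1 ≤ M.prod := by
    refine Nat.pos_of_ne_zero fun h0 => ?_
    exact absurd (h1.pos 0 (Multiset.prod_eq_zero_iff.1 h0)) (lt_irrefl 0)
  have h3 : 2 ^ M.card ≤ 2 ^ (L + n) := by
    calc 2 ^ M.card ≤ M.prod * 2 ^ M.card := Nat.le_mul_of_pos_left _ h2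
      _ ≤ _ := h1.prod_le
      _ ≤ 2 ^ L * 2 ^ n := by
        rw [card_entries]
        exact Nat.mul_le_mul_right _ B.prod_le
      _ = _ := (pow_add _ _ _).symm
  have h4 := (Nat.pow_le_pow_iff_right (by norm_num)).1 h3
  have := B.le
  omega

end SizeBound

/-- Replace the entries of array `2` with indices in the registers `5` and `6`. -/
def replaceProg : Prog :=
  .arith .div 10 10 7 ;; .arith .div 11 11 7 ;; .store 2 5 10 ;; .store 2 6 11 ;;
    .store 2 3 7 ;; incr 3 ;; .const 4 0

/-- Load the pair of entries of array `2` whose number is in register `4`, and compute its gcd. -/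
def pairProg : Prog :=
  .arith .div 5 4 3 ;; modulo 6 4 3 ;; .load 10 2 5 ;; .load 11 2 6 ;; move 7 10 ;; move 8 11 ;;
    gcdProg

/-- Set register `9` to a nonzero number if the loaded pair has to be split, and to `0`
otherwise. -/
def testProg : Prog :=
  .arith .sub 9 10 11 ;; .arith .sub 8 11 10 ;; .arith .add 9 9 8 ;; .const 1 1 ;;
    .arith .sub 8 7 1 ;; .arith .mul 9 9 8

/-- gcd splitting of the entries of array `2`, whose number is in register `3`. -/
def splitProg : Prog :=
  .const 4 0 ;; .arith .mul 12 3 3 ;;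
    .loop 12 (pairProg ;; testProg ;; .ite 9 replaceProg (incr 4) ;;
      .arith .mul 12 3 3 ;; .arith .sub 12 12 4)

namespace Within

variable {W : ℕ} {σ : State}

theorem pairProg {m k : ℕ} (hm : σ.reg 3 = m) (hk : σ.reg 4 = k) :
    Within W pairProg σ (16 * W + 19) fun τ =>
      State.EqOff [5, 6, 7, 8, 9, 10, 11] σ τ ∧ τ.reg 5 = k / m ∧ τ.reg 6 = k % m ∧
      τ.reg 7 = Nat.gcd (σ.arr 2 (k / m)) (σ.arr 2 (k % m)) ∧
      τ.reg 10 = σ.arr 2 (k / m) ∧ τ.reg 11 = σ.arr 2 (k % m) := by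
  refine seq' (div ?_)
  refine seq (k₁ := 3) (k₂ := 16 * W + 15) (by omega) (modulo (by decide) (by decide) ?_)
  refine seq' (load (seq' (load ?_)))
  refine seq (k₁ := 2) (k₂ := 16 * W + 11) (by omega) (move (by decide) ?_)
  refine seq (k₁ := 2) (k₂ := 16 * W + 9) (by omega) (move (by decide) ?_)
  refine gcdProg.mono (by omega) ?_
  rintro τ ⟨⟨h1, h2⟩, h3⟩
  have h5 := h1 5 (by decide)
  have h6 := h1 6 (by decide)
  have h10 := h1 10 (by decide)
  have h11 := h1 11 (by decide)
  simp [hm, hk] at h2 h3 h5 h6 h10 h11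
  refine ⟨⟨fun x hx => ?_, h2⟩, h5, h6, h3, h10, h11⟩
  simp only [List.mem_cons, List.not_mem_nil, or_false, not_or] at hx
  rw [h1 x (by simp [hx])]
  simp [hx]

/-- Register `9` receives `((x - y) + (y - x)) * (g - 1)` in truncated subtraction. For `g = 0` the
last factor would vanish as well, hence `hg0`. -/
theorem testProg {L x y g : ℕ} (hx : σ.reg 10 = x) (hy : σ.reg 11 = y) (hg : σ.reg 7 = g)
    (hxL : x < 2 ^ L) (hyL : y < 2 ^ L) (hgL : g < 2 ^ L) (hg0 : g ≠ 0) :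
    Within (4 * L + 8) testProg σ 6 fun τ => State.EqOff [1, 8, 9] σ τ ∧
      (τ.reg 9 ≠ 0 ↔ x ≠ y ∧ g ≠ 1) := by
  have hL : 2 ^ L < 2 ^ (4 * L + 8) := Nat.pow_lt_pow_right (by norm_num) (by omega)
  refine seq' (sub (seq' (sub (seq' (add ?_ (seq' (const ?_ (seq' (sub (mul ?_ ?_))))))))))
  · simp [hx, hy]; omega
  · exact Nat.one_lt_two_pow (by omega)
  · simp [hx, hy, hg]
    exact mul_lt_two_pow (L := L) (by omega) (by omega)
  · refine ⟨((((((State.EqOff.refl _ _).setReg ?_ _).setReg ?_ _).setReg ?_ _).setReg ?_ _).setReg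
      ?_ _).setReg ?_ _, ?_⟩
    all_goals try decide
    simp [hx, hy, hg]
    omega

theorem replaceProg {m i j x y g : ℕ} (h3 : σ.reg 3 = m) (h5 : σ.reg 5 = i) (h6 : σ.reg 6 = j)
    (h7 : σ.reg 7 = g) (h10 : σ.reg 10 = x) (h11 : σ.reg 11 = y) (hm : m + 1 < 2 ^ W) :
    Within W replaceProg σ 8 fun τ => τ.reg 2 = σ.reg 2 ∧ τ.reg 3 = m + 1 ∧ τ.reg 4 = 0 ∧
      τ.arr 1 = σ.arr 1 ∧ τ.arr 2 =
        Function.update (Function.update (Function.update (σ.arr 2) i (x / g)) j (y / g)) m g := by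
  refine seq' (div (seq' (div (seq' (store (seq' (store (seq' (store ?_)))))))))
  refine seq (k₁ := 2) (k₂ := 1) le_rfl (incr (by decide) ?_ (const (by positivity) ?_))
  · simpa [h3] using hm
  · simp [h3, h5, h6, h7, h10, h11]

/-- Register `4` runs through the numbers `k` of the ordered pairs `(k / m, k % m)`. All earlier
pairs need no split; after a split the scan restarts at `0`. -/
theorem splitProg {n L m₀ : ℕ} {p : ℕ → ℕ} (B : SizeBound n p L) (h2 : σ.reg 2 = n)
    (h3 : σ.reg 3 = m₀) (h : Relation.ReflTransGen SplitStep (entries p n) (entries (σ.arr 2) m₀)) :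
    Within (4 * L + 8) splitProg σ
      ((2 * L * (4 * L ^ 2 + 1) + 4 * L ^ 2) * (64 * L + 165) + 3) fun τ =>
      τ.reg 2 = n ∧ τ.arr 1 = σ.arr 1 ∧
      Relation.ReflTransGen SplitStep (entries p n) (entries (τ.arr 2) (τ.reg 3)) ∧
      ∀ i < τ.reg 3, ∀ j < τ.reg 3, τ.arr 2 i ≠ τ.arr 2 j →
        Nat.gcd (τ.arr 2 i) (τ.arr 2 j) = 1 := by
  have hcard : ∀ A m, Relation.ReflTransGen SplitStep (entries p n) (entries A m) → m ≤ 2 * L := by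
    intro A m hA
    have := B.card_le hA
    rwa [card_entries] at this
  have hsq : ∀ m, m ≤ 2 * L → m * m ≤ 4 * L ^ 2 ∧ m * m + 1 < 2 ^ (4 * L + 8) ∧
      m + 1 < 2 ^ (4 * L + 8) := by
    intro m hm
    have h4 := cube_lt L
    have h5 : m * m ≤ (2 * L) * (2 * L) := Nat.mul_le_mul hm hm
    have h6 : 4 * L ^ 2 + 2 * L + 1 ≤ 8 * (L + 1) ^ 3 := by nlinarith [Nat.zero_le (L ^ 3)]
    have h7 : (2 * L) * (2 * L) = 4 * L ^ 2 := by ring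
    omega
  have hm₀ := hcard _ _ h
  refine seq' (const (by positivity) (seq' (mul ?_ ?_)))
  · have := (hsq m₀ hm₀).2.1
    simp [h3]; omega
  -- The measure counts possible further splits, weighted by `4 * L ^ 2 + 1`, plus the pairs still
  -- to scan. A split saves one weight, more than the at most `4 * L ^ 2` pairs of the restarted
  -- scan.
  refine (loop (k := 64 * L + 164) (a := (2 * L - m₀) * (4 * L ^ 2 + 1) + m₀ * m₀)
    (fun a τ => τ.reg 2 = n ∧ τ.arr 1 = σ.arr 1 ∧
      Relation.ReflTransGen SplitStep (entries p n) (entries (τ.arr 2) (τ.reg 3)) ∧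
      τ.reg 4 ≤ τ.reg 3 * τ.reg 3 ∧ τ.reg 12 = τ.reg 3 * τ.reg 3 - τ.reg 4 ∧
      a = (2 * L - τ.reg 3) * (4 * L ^ 2 + 1) + τ.reg 12 ∧
      ∀ k < τ.reg 4, τ.arr 2 (k / τ.reg 3) ≠ τ.arr 2 (k % τ.reg 3) →
        Nat.gcd (τ.arr 2 (k / τ.reg 3)) (τ.arr 2 (k % τ.reg 3)) = 1) ?_ ?_).mono ?_ ?_
  · rintro a τ ⟨i2, i1, iA, i4, i12, rfl, iok⟩ hx
    obtain ⟨m, hm⟩ : ∃ m, τ.reg 3 = m := ⟨_, rfl⟩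
    obtain ⟨k, hk⟩ : ∃ k, τ.reg 4 = k := ⟨_, rfl⟩
    rw [hm, hk] at i12 i4
    rw [hm] at iA
    have hkm : k < m * m := by omega
    have hm0 : 0 < m := by
      rcases Nat.eq_zero_or_pos m with h0 | h0
      · subst h0; omega
      · exact h0
    have hmL := hcard _ _ iA
    obtain ⟨hmm, hmm', hm1⟩ := hsq m hmL
    set A := τ.arr 2 with hA
    set i := k / m with hi
    set j := k % m with hj
    have him : i < m := Nat.div_lt_of_lt_mul hkm
    have hjm : j < m := Nat.mod_lt _ hm0
    have hAi : A i ∈ entries A m := mem_entries.2 ⟨i, him, rfl⟩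
    have hAj : A j ∈ entries A m := mem_entries.2 ⟨j, hjm, rfl⟩
    have hApos := (B.splitInvariant iA).pos _ hAi
    have hgpos : 0 < Nat.gcd (A i) (A j) := Nat.gcd_pos_of_pos_left _ hApos
    have hgL : Nat.gcd (A i) (A j) < 2 ^ L :=
      (Nat.gcd_le_left _ hApos).trans_lt (B.lt_of_mem iA hAi)
    refine seq (k₁ := 64 * L + 147) (k₂ := 17) (by omega)
      ((pairProg hm hk).mono (by omega) ?_)
    rintro ρ ⟨⟨e1, e2⟩, e5, e6, e7, e10, e11⟩
    refine seq (k₁ := 6) (k₂ := 11) (by omega)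
      ((testProg e10 e11 e7 (B.lt_of_mem iA hAi) (B.lt_of_mem iA hAj) hgL hgpos.ne').mono le_rfl ?_)
    rintro υ ⟨⟨f1, f2⟩, f9⟩
    have g2 : υ.reg 2 = n := by rw [f1 2 (by decide), e1 2 (by decide), i2]
    have g3 : υ.reg 3 = m := by rw [f1 3 (by decide), e1 3 (by decide), hm]
    have g4 : υ.reg 4 = k := by rw [f1 4 (by decide), e1 4 (by decide), hk]
    have g5 : υ.reg 5 = i := by rw [f1 5 (by decide), e5]
    have g6 : υ.reg 6 = j := by rw [f1 6 (by decide), e6]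
    have g7 : υ.reg 7 = Nat.gcd (A i) (A j) := by rw [f1 7 (by decide), e7]
    have g10 : υ.reg 10 = A i := by rw [f1 10 (by decide), e10]
    have g11 : υ.reg 11 = A j := by rw [f1 11 (by decide), e11]
    have ga : υ.arr = τ.arr := f2.trans e2
    refine seq (k₁ := 9) (k₂ := 2) (by omega) (ite (fun h9 => ?_) fun h9 => ?_)
    · obtain ⟨hne, hg1⟩ := f9.1 h9
      refine (replaceProg g3 g5 g6 g7 g10 g11 hm1).mono le_rfl ?_
      rintro ω ⟨w2, w3, w4, wa1, wa2⟩
      rw [ga] at wa1 wa2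
      have wA : Relation.ReflTransGen SplitStep (entries p n) (entries (ω.arr 2) (m + 1)) := by
        rw [wa2]
        exact iA.tail (splitStep_entries him hjm hne hg1)
      have hm1L := hcard _ _ wA
      obtain ⟨hq1, hq2, -⟩ := hsq _ hm1L
      refine seq' (mul ?_ (sub ?_))
      · rw [w3]; omega
      refine ⟨_, ?_, ?_, ?_, ?_, ?_, ?_, rfl, ?_⟩
      · have h5 : (2 * L - m) * (4 * L ^ 2 + 1) =
            (2 * L - (m + 1)) * (4 * L ^ 2 + 1) + (4 * L ^ 2 + 1) := by
          rw [show 2 * L - m = (2 * L - (m + 1)) + 1 by omega]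
          ring
        rw [hm, h5, i12]
        clear_value i j
        generalize m + 1 = m' at *
        simp [w3, w4]
        omega
      · simp [w2, g2]
      · simp [wa1, i1]
      · simpa [w3] using wA
      · simp [w4]
      · simp [w3, w4]
      · simp [w4]
    · refine (incr (k := 6) (by decide) (by rw [g4]; omega) ?_)
      have hcop : A i ≠ A j → Nat.gcd (A i) (A j) = 1 := by
        intro hne
        by_contra hg1
        exact f9.2 ⟨hne, hg1⟩ h9
      refine seq' (mul ?_ (sub ?_))
      · simp [g3]; omega
      refine ⟨_, ?_, ?_, ?_, ?_, ?_, ?_, rfl, ?_⟩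
      · simp [g3, g4, hm, i12]
        omega
      · simp [g2]
      · simp [ga, i1]
      · simpa [ga, g3] using iA
      · simp [g3, g4]; omega
      · simp [g3, g4]
      · simp [g3, g4, ga]
        intro k' hk'
        rcases hk'.lt_or_eq with hk' | rfl
        · have := iok k' (by rw [hk]; exact hk')
          rwa [hm] at this
        · exact hcop
  · simp [h2, h3, h]
  · have h5 : (2 * L - m₀) * (4 * L ^ 2 + 1) ≤ 2 * L * (4 * L ^ 2 + 1) :=
      Nat.mul_le_mul_right _ (by omega)
    have h6 := (hsq m₀ hm₀).1
    have h7 := Nat.mul_le_mul_right (64 * L + 164 + 1)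
      (show (2 * L - m₀) * (4 * L ^ 2 + 1) + m₀ * m₀ ≤
        2 * L * (4 * L ^ 2 + 1) + 4 * L ^ 2 by omega)
    exact Nat.succ_le_succ h7
  · rintro τ ⟨a, ⟨i2, i1, iA, i4, i12, -, iok⟩, h0⟩
    refine ⟨i2, i1, iA, fun i hi j hj => ?_⟩
    -- On exit register `12` is `0`, so all pairs were scanned; `(i, j)` is pair number `i * m + j`,
    -- where `m` is the content of register `3`.
    have hlt : i * τ.reg 3 + j < τ.reg 4 := by
      have h5 : (i + 1) * τ.reg 3 ≤ τ.reg 3 * τ.reg 3 := Nat.mul_le_mul_right _ hi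
      rw [add_mul] at h5
      omega
    have h6 := iok _ hlt
    have h7 : (i * τ.reg 3 + j) / τ.reg 3 = i := by
      rw [mul_comm, Nat.mul_add_div (by omega), Nat.div_eq_of_lt hj, add_zero]
    have h8 : (i * τ.reg 3 + j) % τ.reg 3 = j := by
      rw [mul_comm, Nat.mul_add_mod, Nat.mod_eq_of_lt hj]
    rwa [h7, h8] at h6

end Within

end RAM

/-! ### The program for the attributes -/

/-- The first `d` entries of `F`, `H` list in increasing lexicographic order the pairs `(x, t)`
with `S x t` for which `x ∈ V` and `x ^ (t + 1)` divides some `p j`; the entries of `G` are the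
powers `x ^ (t + 1)`. -/
structure CodePrefix (n : ℕ) (p : ℕ → ℕ) (V : Finset ℕ) (d : ℕ) (F G H : ℕ → ℕ)
    (S : ℕ → ℕ → Prop) : Prop where
  pow : ∀ i < d, G i = F i ^ (H i + 1)
  lex : ∀ i k, i < k → k < d → F i < F k ∨ F i = F k ∧ H i < H k
  mem_iff : ∀ x t, (∃ i < d, F i = x ∧ H i = t) ↔ x ∈ V ∧ (∃ j < n, x ^ (t + 1) ∣ p j) ∧ S x t

namespace CodePrefix

variable {n d : ℕ} {p : ℕ → ℕ} {V : Finset ℕ} {F G H : ℕ → ℕ} {S S' : ℕ → ℕ → Prop}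

theorem congr (C : CodePrefix n p V d F G H S)
    (h : ∀ x ∈ V, ∀ t, (∃ j < n, x ^ (t + 1) ∣ p j) → (S x t ↔ S' x t)) :
    CodePrefix n p V d F G H S' := by
  refine ⟨C.pow, C.lex, fun x t => ?_⟩
  rw [C.mem_iff]
  constructor
  · rintro ⟨h1, h2, h3⟩; exact ⟨h1, h2, (h x h1 t h2).1 h3⟩
  · rintro ⟨h1, h2, h3⟩; exact ⟨h1, h2, (h x h1 t h2).2 h3⟩

/-- Every recorded pair precedes `(v, k)` lexicographically, and `(v, k)` is the only pair by which
the new condition exceeds the old one. -/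
theorem push {v k : ℕ} (C : CodePrefix n p V d F G H fun x t => x < v ∨ x = v ∧ t < k)
    (hv : v ∈ V) (hk : ∃ j < n, v ^ (k + 1) ∣ p j) :
    CodePrefix n p V (d + 1) (Function.update F d v) (Function.update G d (v ^ (k + 1)))
      (Function.update H d k) fun x t => x < v ∨ x = v ∧ t < k + 1 := by
  refine ⟨fun i hi => ?_, fun i l hil hl => ?_, fun x t => ?_⟩
  · rcases Nat.lt_succ_iff_lt_or_eq.1 hi with hi | rfl
    · simpa [Function.update_of_ne hi.ne] using C.pow i hi
    · simp
  · rcases Nat.lt_succ_iff_lt_or_eq.1 hl with hl | rfl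
    · have := C.lex i l hil hl
      simpa [Function.update_of_ne hl.ne, Function.update_of_ne (hil.trans hl).ne] using this
    · have := ((C.mem_iff _ _).1 ⟨i, hil, rfl, rfl⟩).2.2
      simpa [Function.update_of_ne hil.ne] using this
  · constructor
    · rintro ⟨i, hi, hx, ht⟩
      rcases Nat.lt_succ_iff_lt_or_eq.1 hi with hi | rfl
      · rw [Function.update_of_ne hi.ne] at hx ht
        obtain ⟨h1, h2, h3⟩ := (C.mem_iff x t).1 ⟨i, hi, hx, ht⟩
        exact ⟨h1, h2, by omega⟩
      · rw [Function.update_self] at hx ht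
        subst hx ht
        exact ⟨hv, hk, by omega⟩
    · rintro ⟨h1, h2, h3⟩
      by_cases h4 : x < v ∨ x = v ∧ t < k
      · obtain ⟨i, hi, hx, ht⟩ := (C.mem_iff x t).2 ⟨h1, h2, h4⟩
        refine ⟨i, by omega, ?_, ?_⟩
        · rwa [Function.update_of_ne hi.ne]
        · rwa [Function.update_of_ne hi.ne]
      · refine ⟨d, by omega, ?_, ?_⟩
        · rw [Function.update_self]; omega
        · rw [Function.update_self]; omega

end CodePrefix

namespace RAM

/-- Append an attribute. -/
def pushProg : Prog :=
  .const 1 2 ;; .arith .add 9 15 1 ;; .store 0 9 13 ;; .store 4 15 14 ;; incr 15 ;;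
    .arith .mul 14 14 13

/-- Proceed to the next value range. -/
def advanceProg : Prog :=
  nextProg ;; move 13 16 ;; move 14 16

/-- Write the number of attributes to register `15`, the value ranges `f i` to the cells `i + 2` of
array `0`, and the powers of the value ranges that mark the attributes to array `4`. -/
def codeProg : Prog :=
  .const 13 1 ;; .const 15 0 ;; advanceProg ;; .loop 13 (anyDvdProg ;; .ite 16 pushProg advanceProg)

namespace Within

variable {W : ℕ} {σ : State}

theorem pushProg {d v w : ℕ} (h13 : σ.reg 13 = v) (h14 : σ.reg 14 = w) (h15 : σ.reg 15 = d)
    (hd : d + 2 < 2 ^ W) (hw : w * v < 2 ^ W) :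
    Within W pushProg σ 7 fun τ => τ.reg 2 = σ.reg 2 ∧ τ.reg 3 = σ.reg 3 ∧ τ.reg 13 = v ∧
      τ.reg 14 = w * v ∧ τ.reg 15 = d + 1 ∧ τ.arr 1 = σ.arr 1 ∧ τ.arr 2 = σ.arr 2 ∧
      τ.arr 0 = Function.update (σ.arr 0) (d + 2) v ∧
      τ.arr 4 = Function.update (σ.arr 4) d w := by
  refine seq' (const (by omega) (seq' (add ?_ (seq' (store (seq' (store ?_)))))))
  · simpa [h15] using hd
  refine seq (k₁ := 2) (k₂ := 1) le_rfl (incr (by decide) ?_ (mul ?_ ?_))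
  · simp [h15]; omega
  · simpa [h13, h14] using hw
  · simp [h13, h14, h15]

/-- Starting from at least `1` skips the entries equal to `1` that splitting leaves behind. The
value `0` signals that the base is exhausted. -/
theorem advanceProg {m : ℕ} {V : Finset ℕ} (hm : σ.reg 3 = m)
    (hV : (entries (σ.arr 2) m).toFinset.erase 1 = V) (h13 : 1 ≤ σ.reg 13) :
    Within W advanceProg σ (m * 12 + 8) fun τ =>
      State.EqOff [1, 4, 9, 10, 12, 13, 14, 16] σ τ ∧ τ.reg 14 = τ.reg 13 ∧
      ((τ.reg 13 = 0 ∧ ∀ x ∈ V, x ≤ σ.reg 13) ∨ (τ.reg 13 ∈ V ∧ σ.reg 13 < τ.reg 13 ∧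
        ∀ x ∈ V, σ.reg 13 < x → τ.reg 13 ≤ x)) := by
  refine seq (k₁ := m * 12 + 4) (k₂ := 4) le_rfl ((nextProg hm).mono le_rfl ?_)
  rintro τ ⟨⟨h1, h2⟩, h3⟩
  refine seq (k₁ := 2) (k₂ := 2) le_rfl (move (by decide) (move (by decide) ?_))
  have hmem : ∀ x, 1 < x → (x ∈ V ↔ ∃ i < m, σ.arr 2 i = x) := by
    intro x hx
    rw [← hV, Finset.mem_erase, Multiset.mem_toFinset, mem_entries]
    simp [hx.ne']
  have hmem' : ∀ x ∈ V, ∃ i < m, σ.arr 2 i = x := by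
    intro x hx
    rw [← hV, Finset.mem_erase, Multiset.mem_toFinset, mem_entries] at hx
    exact hx.2
  refine ⟨⟨fun x hx => ?_, h2⟩, by simp, ?_⟩
  · simp only [List.mem_cons, List.not_mem_nil, or_false, not_or] at hx
    simp [hx, h1]
  · simp
    rcases h3 with ⟨h3, h4⟩ | ⟨h3, h4, h5⟩
    · refine Or.inl ⟨h3, fun x hx => ?_⟩
      obtain ⟨i, hi, rfl⟩ := hmem' x hx
      exact h4 i hi
    · refine Or.inr ⟨(hmem _ (by omega)).2 h3, h4, fun x hx => ?_⟩
      obtain ⟨i, hi, rfl⟩ := hmem' x hx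
      exact h5 i hi

/-- The members `v` of the base are visited in increasing order, and for each one the powers `v ^ (k
+ 1)` are recorded as long as they divide some period. -/
theorem codeProg {n L m : ℕ} {p : ℕ → ℕ} {V : Finset ℕ} (B : SizeBound n p L) (h2 : σ.reg 2 = n)
    (h3 : σ.reg 3 = m) (hp : ∀ j < n, σ.arr 1 j = p j)
    (hV : (entries (σ.arr 2) m).toFinset.erase 1 = V) (hm : m ≤ 2 * L) (hbase : IsCoprimeBase V)
    (hdvd : ∀ x ∈ V, ∃ j < n, x ∣ p j) :
    Within (4 * L + 8) codeProg σ ((2 * L * (L + 1) + L) * (34 * L + 14) + 24 * L + 11) fun τ =>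
      τ.reg 2 = n ∧ τ.arr 1 = σ.arr 1 ∧ τ.reg 15 ≤ 2 * L * (L + 1) + L ∧
      ∃ H, CodePrefix n p V (τ.reg 15) (fun i => τ.arr 0 (i + 2)) (τ.arr 4) H
        fun _ _ => True := by
  have hlt : ∀ x ∈ V, x < 2 ^ L := by
    intro x hx
    obtain ⟨j, hj, hxj⟩ := hdvd x hx
    exact (Nat.le_of_dvd (B.pos j hj) hxj).trans_lt (B.lt j hj)
  have hVcard : V.card ≤ 2 * L := by
    rw [← hV]
    refine (Finset.card_erase_le).trans ((Multiset.toFinset_card_le _).trans ?_)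
    rwa [card_entries]
  let cnt : ℕ → ℕ := fun v => (V.filter (v ≤ ·)).card
  have hcnt : ∀ v, cnt v ≤ 2 * L := fun v => (Finset.card_filter_le _ _).trans hVcard
  have hcnt_lt : ∀ v b, v ∈ V → v < b → cnt b < cnt v := by
    intro v b hv hvb
    refine Finset.card_lt_card ?_
    rw [Finset.ssubset_iff_of_subset]
    · exact ⟨v, by simp [hv], by simp [hvb]⟩
    · intro x hx
      rw [Finset.mem_filter] at hx ⊢
      exact ⟨hx.1, hvb.le.trans hx.2⟩
  have hcube : 2 * L * (L + 1) + L + 2 < 2 ^ (4 * L + 8) := by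
    have := cube_lt L
    nlinarith [Nat.zero_le (L ^ 3), Nat.zero_le (L ^ 2)]
  -- The measure `a` orders the pairs `(v, k)` lexicographically: `cnt v` counts the members from
  -- `v` on, and `L - k` bounds the remaining powers. As `τ.reg 15 + a` never grows, it bounds the
  -- number of attributes too. `τ.reg 13 = 0` means completion.
  let J : ℕ → State → Prop := fun a τ => τ.reg 2 = n ∧ τ.reg 3 = m ∧ τ.arr 1 = σ.arr 1 ∧
    τ.arr 2 = σ.arr 2 ∧ τ.reg 15 + a ≤ 2 * L * (L + 1) + L ∧ ∃ H k,
      CodePrefix n p V (τ.reg 15) (fun i => τ.arr 0 (i + 2)) (τ.arr 4) H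
        (fun x t => τ.reg 13 = 0 ∨ x < τ.reg 13 ∨ x = τ.reg 13 ∧ t < k) ∧
      (τ.reg 13 ≠ 0 → τ.reg 13 ∈ V ∧ τ.reg 14 = τ.reg 13 ^ (k + 1) ∧ k ≤ L ∧
        a = cnt (τ.reg 13) * (L + 1) + (L - k))
  -- Needed twice: to enter the first value, starting from `1`, and to leave an exhausted one.
  have advance : ∀ (a : ℕ) (τ : State) (H : ℕ → ℕ), τ.reg 2 = n → τ.reg 3 = m →
      τ.arr 1 = σ.arr 1 → τ.arr 2 = σ.arr 2 → τ.reg 15 + a ≤ 2 * L * (L + 1) + L →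
      1 ≤ τ.reg 13 → (∀ b, τ.reg 13 < b → b ∈ V → cnt b * (L + 1) + L ≤ a) →
      CodePrefix n p V (τ.reg 15) (fun i => τ.arr 0 (i + 2)) (τ.arr 4) H
        (fun x _ => x ≤ τ.reg 13) →
      Within (4 * L + 8) RAM.advanceProg τ (24 * L + 8) fun ρ => ∃ b, b ≤ a ∧ J b ρ ∧
        (b = 0 ∨ ρ.reg 13 ≠ 0) ∧ (ρ.reg 13 ≠ 0 → τ.reg 13 < ρ.reg 13 ∧ ρ.reg 13 ∈ V ∧
          b = cnt (ρ.reg 13) * (L + 1) + L) := by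
    intro a τ H i2 i3 i1 iA iD i13 ia C
    refine (advanceProg (V := V) i3 (by rw [iA]; exact hV) i13).mono (by omega) ?_
    rintro ρ ⟨⟨e1, e2⟩, e14, ⟨e13, e3⟩ | ⟨e13, e3, e4⟩⟩
    · refine ⟨0, by omega, ⟨?_, ?_, ?_, ?_, ?_, H, 0, ?_, fun h => absurd e13 h⟩, Or.inl rfl,
        fun h => absurd e13 h⟩
      · rw [e1 2 (by decide), i2]
      · rw [e1 3 (by decide), i3]
      · rw [e2, i1]
      · rw [e2, iA]
      · rw [e1 15 (by decide)]; omega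
      · rw [e2, e1 15 (by decide)]
        refine C.congr fun x hx t _ => ?_
        simp [e13, e3 x hx]
    · have hne : ρ.reg 13 ≠ 0 := by omega
      have hle := ia _ e3 e13
      refine ⟨cnt (ρ.reg 13) * (L + 1) + L, hle, ⟨?_, ?_, ?_, ?_, ?_, H, 0, ?_,
        fun _ => ⟨e13, by simp [e14], Nat.zero_le _, by simp⟩⟩, Or.inr hne,
        fun _ => ⟨e3, e13, rfl⟩⟩
      · rw [e1 2 (by decide), i2]
      · rw [e1 3 (by decide), i3]
      · rw [e2, i1]
      · rw [e2, iA]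
      · rw [e1 15 (by decide)]; omega
      · rw [e2, e1 15 (by decide)]
        refine C.congr fun x hx t _ => ?_
        have := e4 x hx
        simp only [hne, false_or, Nat.not_lt_zero, and_false, or_false]
        omega
  refine seq' (const (Nat.one_lt_two_pow (by omega)) (seq' (const (by positivity) ?_)))
  refine seq (k₁ := 24 * L + 8) (k₂ := (2 * L * (L + 1) + L) * (34 * L + 14) + 1) (by omega)
    ((advance (2 * L * (L + 1) + L) _ (fun _ => 0) ?_ ?_ ?_ ?_ ?_ ?_ ?_ ?_).mono le_rfl ?_)
  · simp [h2]
  · simp [h3]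
  · simp
  · simp
  · simp
  · simp
  · intro b _ _
    exact Nat.add_le_add_right (Nat.mul_le_mul_right _ (hcnt b)) _
  -- The empty list records all pairs with `x ≤ 1`, as members of the base are at least `2`.
  · refine ⟨by simp, by simp, fun x t => ?_⟩
    simp
    intro hx _ _ _
    exact hbase.1 x hx
  rintro τ ⟨a, ha, hJ, -, -⟩
  refine (loop (k := 34 * L + 13) J ?_ hJ).mono ?_ ?_
  · rintro a τ ⟨i2, i3, i1, iA, iD, H, k, C, hne⟩ h13
    obtain ⟨hvV, h14, hkL, rfl⟩ := hne h13
    refine seq (k₁ := 10 * L + 4) (k₂ := 24 * L + 9) (by omega)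
      ((anyDvdProg (by omega) i2).mono (by have := B.le; omega) ?_)
    rintro ρ ⟨⟨e1, e2⟩, e16⟩
    obtain ⟨v, hv⟩ : ∃ v, τ.reg 13 = v := ⟨_, rfl⟩
    obtain ⟨d, hd⟩ : ∃ d, τ.reg 15 = d := ⟨_, rfl⟩
    have hany : ρ.reg 16 ≠ 0 ↔ ∃ j < n, v ^ (k + 1) ∣ p j := by
      rw [e16, i1, h14, hv]
      refine exists_congr fun j => and_congr_right fun hj => ?_
      rw [hp j hj]
    have g2 : ρ.reg 2 = n := by rw [e1 2 (by decide), i2]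
    have g3 : ρ.reg 3 = m := by rw [e1 3 (by decide), i3]
    have g13 : ρ.reg 13 = v := by rw [e1 13 (by decide), hv]
    have g14 : ρ.reg 14 = v ^ (k + 1) := by rw [e1 14 (by decide), h14, hv]
    have g15 : ρ.reg 15 = d := by rw [e1 15 (by decide), hd]
    rw [hv] at hvV h13 iD ⊢
    rw [hv, hd] at C
    rw [hd] at iD
    have hv2 := hbase.1 v hvV
    simp only [h13, false_or] at C
    refine ite (fun h16 => ?_) fun h16 => ?_
    · obtain ⟨j, hj, hjd⟩ := hany.1 h16
      have hple : v ^ (k + 1) < 2 ^ L := (Nat.le_of_dvd (B.pos j hj) hjd).trans_lt (B.lt j hj)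
      -- From `2 ^ (k + 1) ≤ v ^ (k + 1) ≤ p j < 2 ^ L`.
      have hkL' : k + 1 < L := by
        have h5 : 2 ^ (k + 1) ≤ v ^ (k + 1) := Nat.pow_le_pow_left hv2 _
        exact (Nat.pow_lt_pow_iff_right (by norm_num)).1 (h5.trans_lt hple)
      refine (pushProg g13 g14 g15 (by omega) (mul_lt_two_pow hple (hlt v hvV))).mono
        (by omega) ?_
      rintro ω ⟨w2, w3, w13, w14, w15, wa1, wa2, wa0, wa4⟩
      refine ⟨cnt v * (L + 1) + (L - (k + 1)), by omega, ?_, ?_, ?_, ?_, ?_,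
        Function.update H d k, k + 1, ?_, ?_⟩
      · rw [w2, g2]
      · rw [w3, g3]
      · rw [wa1, e2, i1]
      · rw [wa2, e2, iA]
      · rw [w15]; omega
      · have h6 : (fun i => ω.arr 0 (i + 2)) =
            Function.update (fun i => τ.arr 0 (i + 2)) d v := by
          funext i
          rw [wa0, e2]
          simp [Function.update_apply]
        rw [h6, wa4, e2, w15, w13]
        simp only [h13, false_or]
        exact C.push hvV ⟨j, hj, hjd⟩
      · intro _
        rw [w13, w14]
        exact ⟨hvV, (pow_succ _ _).symm, hkL'.le, rfl⟩
    · have hno : ¬ ∃ j < n, v ^ (k + 1) ∣ p j := fun h => hany.2 h h16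
      have hpos : 0 < cnt v := Finset.card_pos.2 ⟨v, by simp [hvV]⟩
      have hdec : ∀ b, v < b → b ∈ V →
          cnt b * (L + 1) + L ≤ cnt v * (L + 1) + (L - k) - 1 := by
        intro b hb _
        have h5 : (cnt b + 1) * (L + 1) ≤ cnt v * (L + 1) :=
          Nat.mul_le_mul_right _ (hcnt_lt v b hvV hb)
        rw [add_mul] at h5
        omega
      have hpos' : 0 < cnt v * (L + 1) := Nat.mul_pos hpos (Nat.succ_pos L)
      refine (advance (cnt v * (L + 1) + (L - k) - 1) ρ H g2 g3 (by rw [e2, i1])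
        (by rw [e2, iA]) (by rw [g15]; omega) (by omega) (by rw [g13]; exact hdec) ?_).mono
        (by omega) ?_
      · rw [e2, g15, g13]
        -- As `v ^ (k + 1)` divides no period, neither does a higher power, so all pairs with value
        -- `v` are recorded.
        refine C.congr fun x hx t ht => ?_
        have : x = v → t < k := by
          rintro rfl
          by_contra hcon
          obtain ⟨j, hj, hjd⟩ := ht
          exact hno ⟨j, hj, (pow_dvd_pow x (by omega)).trans hjd⟩
        omega
      · rintro ω ⟨b, hb, hJb, -⟩
        exact ⟨b, by omega, hJb⟩
  · exact Nat.succ_le_succ (Nat.mul_le_mul_right _ ha)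
  · rintro ρ ⟨b, ⟨i2, i3, i1, iA, iD, H, k, C, -⟩, h0⟩
    refine ⟨i2, i1, by omega, H, C.congr fun x _ t _ => ?_⟩
    simp [h0]

end Within

end RAM

/-! ### The reduction -/

namespace RAM

/-- Write the Partial Coding instance to array `0`. -/
def outProg : Prog :=
  .const 9 0 ;; .store 0 9 15 ;; .const 9 1 ;; .store 0 9 2 ;; .arith .mul 3 2 15 ;; .const 17 2 ;;
    .arith .add 17 17 15 ;;
    forLoop 4 3 (.arith .div 5 4 15 ;; modulo 6 4 15 ;; .load 10 1 5 ;; .load 14 4 6 ;;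
      modulo 9 10 14 ;; .const 8 1 ;; .arith .sub 8 8 9 ;; .arith .add 9 17 4 ;; .store 0 9 8) ;;
    .arith .add 0 17 3

/-- The reduction of Windows Scheduling to Partial Coding. -/
def reductionProg : Prog :=
  copyProg ;; splitProg ;; codeProg ;; outProg

/-- The value ranges are already in place behind the two header cells. The incidence matrix is
written row by row: cell `k` belongs to symbol `k / d` and attribute `k % d`. -/
theorem Within.outProg {W n d : ℕ} {σ : State} (h2 : σ.reg 2 = n) (h15 : σ.reg 15 = d)
    (hW : n * d + d + 2 < 2 ^ W) :
    Within W outProg σ (n * d * 17 + 11) fun τ => τ.reg 0 = d + 2 + n * d ∧ τ.arr 0 0 = d ∧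
      τ.arr 0 1 = n ∧ (∀ i < d, τ.arr 0 (i + 2) = σ.arr 0 (i + 2)) ∧
      ∀ k < n * d, τ.arr 0 (d + 2 + k) =
        if σ.arr 4 (k % d) ∣ σ.arr 1 (k / d) then 1 else 0 := by
  refine seq' (const (by omega) (seq' (store (seq' (const (by omega) (seq' (store (seq'
    (mul ?_ (seq' (const (by omega) (seq' (add ?_ ?_)))))))))))))
  · simp [h2, h15]; omega
  · simp [h15]; omega
  refine seq (k₁ := n * d * 17 + 3) (k₂ := 1) (by omega) ((forLoop (k := 13) (N := n * d)
    (fun l τ => τ.reg 15 = d ∧ τ.reg 17 = d + 2 ∧ τ.arr 1 = σ.arr 1 ∧ τ.arr 4 = σ.arr 4 ∧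
      τ.arr 0 0 = d ∧ τ.arr 0 1 = n ∧ (∀ i < d, τ.arr 0 (i + 2) = σ.arr 0 (i + 2)) ∧
      ∀ k < l, τ.arr 0 (d + 2 + k) = if σ.arr 4 (k % d) ∣ σ.arr 1 (k / d) then 1 else 0)
    (by decide) (by decide) (by decide) (by decide) (by decide) (by simp [h2, h15]) ?_ ?_).mono
    le_rfl ?_)
  · intro v
    simp [h2, h15, add_comm]
  · rintro l hl τ ⟨i15, i17, i1, i4, ia0, ia1, iF, iB⟩ hl4 hl3
    refine seq' (div ?_)
    refine seq (k₁ := 3) (k₂ := 9) le_rfl (modulo (by decide) (by decide) ?_)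
    refine seq' (load (seq' (load ?_)))
    refine seq (k₁ := 3) (k₂ := 4) le_rfl (modulo (by decide) (by decide) ?_)
    refine seq' (const (Nat.one_lt_two_pow (by rintro rfl; omega)) (seq' (sub (seq' (add ?_
      (store ?_))))))
    · simp [i17, hl4]; omega
    · refine ⟨by simp [hl4], by simp [hl3], fun v => ?_⟩
      simp [i15, i17, i1, i4, hl4]
      refine ⟨?_, ?_, ?_, ?_⟩
      · rw [Function.update_of_ne (by omega)]; exact ia0
      · rw [Function.update_of_ne (by omega)]; exact ia1
      · intro i hi
        rw [Function.update_of_ne (by omega)]; exact iF i hi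
      · intro k hk
        rcases hk.lt_or_eq with hk | rfl
        · rw [Function.update_of_ne (by omega)]; exact iB k hk
        · rw [Function.update_self]
          -- The bit is `1 - r` in truncated subtraction, `r` being the remainder; it is `1` exactly
          -- when `r = 0`.
          split
          · next h => rw [Nat.mod_eq_zero_of_dvd h]
          · next h =>
            have : σ.arr 1 (k / d) % σ.arr 4 (k % d) ≠ 0 := fun h0 =>
              h (Nat.dvd_of_mod_eq_zero h0)
            omega
  · rintro τ ⟨⟨i15, i17, i1, i4, ia0, ia1, iF, iB⟩, i3⟩
    refine add ?_ ?_
    · rw [i17, i3]; omega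
    · simp only [State.reg_setReg, State.arr_setReg, if_true, i17, i3]
      exact ⟨trivial, ia0, ia1, iF, iB⟩

/-- A bound on the number of instructions of `reductionProg`. -/
def stepBound (L : ℕ) : ℕ :=
  7 * L + 7 + ((2 * L * (4 * L ^ 2 + 1) + 4 * L ^ 2) * (64 * L + 165) + 3) +
    ((2 * L * (L + 1) + L) * (34 * L + 14) + 24 * L + 11) +
    (L * (2 * L * (L + 1) + L) * 17 + 11)

theorem Within.reductionProg {n L : ℕ} {σ : State} (B : SizeBound n (σ.arr 0) L)
    (h0 : σ.reg 0 = n) :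
    Within (4 * L + 8) reductionProg σ (stepBound L) fun τ =>
      ∃ (M : Multiset ℕ) (d : ℕ) (F G H : ℕ → ℕ),
        IsSplitResult (entries (σ.arr 0) n) M ∧ IsCoprimeBase (M.toFinset.erase 1) ∧
        CodePrefix n (σ.arr 0) (M.toFinset.erase 1) d F G H (fun _ _ => True) ∧
        τ.reg 0 = d + 2 + n * d ∧ τ.arr 0 0 = d ∧ τ.arr 0 1 = n ∧
        (∀ i < d, τ.arr 0 (i + 2) = F i) ∧
        ∀ k < n * d, τ.arr 0 (d + 2 + k) =
          if G (k % d) ∣ σ.arr 0 (k / d) then 1 else 0 := by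
  have hn := B.le
  refine seq (k₁ := 7 * L + 7) (k₂ := ((2 * L * (4 * L ^ 2 + 1) + 4 * L ^ 2) * (64 * L + 165) + 3) +
    (((2 * L * (L + 1) + L) * (34 * L + 14) + 24 * L + 11) +
    (L * (2 * L * (L + 1) + L) * 17 + 11))) (by unfold stepBound; omega)
    ((copyProg h0).mono (by omega) ?_)
  rintro τ ⟨h2, h3, h1, hA⟩
  have he : entries (τ.arr 2) n = entries (σ.arr 0) n :=
    Multiset.map_congr rfl fun x hx => hA x (Multiset.mem_range.1 hx)
  refine seq (k₁ := _) (k₂ := _) le_rfl ((splitProg B h2 h3 ?_).mono le_rfl ?_)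
  · rw [he]
  rintro υ ⟨g2, g1, gA, gcop⟩
  have hinv := B.splitInvariant gA
  have hbase := isCoprimeBase_entries hinv.pos gcop
  refine seq (k₁ := _) (k₂ := _) le_rfl ((codeProg B g2 rfl (fun j hj => by rw [g1, h1 j hj]) rfl
    ?_ hbase ?_).mono le_rfl ?_)
  · have := B.card_le gA
    rwa [card_entries] at this
  · intro x hx
    rw [Finset.mem_erase, Multiset.mem_toFinset] at hx
    obtain ⟨y, hy, hxy⟩ := hinv.dvd x hx.2
    obtain ⟨j, hj, rfl⟩ := mem_entries.1 hy
    exact ⟨j, hj, hxy⟩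
  rintro ρ ⟨k2, k1, kd, H, C⟩
  have hnd : n * ρ.reg 15 ≤ L * (2 * L * (L + 1) + L) := Nat.mul_le_mul hn kd
  refine (outProg k2 rfl ?_).mono (by omega) ?_
  · have h5 := cube_lt L
    have h6 : L * (2 * L * (L + 1) + L) + (2 * L * (L + 1) + L) + 2 ≤ 8 * (L + 1) ^ 3 := by
      ring_nf
      nlinarith [Nat.zero_le (L ^ 3), Nat.zero_le (L ^ 2)]
    omega
  · rintro ω ⟨o0, o1, o2, o3, o4⟩
    refine ⟨_, _, _, _, H, ⟨gA, not_splitStep_entries gcop⟩, hbase, C, o0, o1, o2, o3, ?_⟩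
    intro k hk
    rw [o4 k hk, k1, g1, h1]
    exact Nat.div_lt_of_lt_mul (by rwa [mul_comm])

theorem entries_getD (l : List ℕ) : entries (fun i => l.getD i 0) l.length = l := by
  rw [entries, ← Multiset.coe_range, Multiset.map_coe]
  congr 1
  refine List.ext_getElem (by simp) fun i h1 h2 => ?_
  simp [h2]

/-- Each entry is below 2 to its bit length, so the product is at most 2 to the total length; the
separators give `n ≤ L`. -/
theorem sizeBound_getD {l : List ℕ} (h : ∀ x ∈ l, 0 < x) :
    SizeBound l.length (fun i => l.getD i 0) (bitSize l) := by
  have hmem : ∀ j < l.length, l.getD j 0 ∈ l := by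
    intro j hj
    simp [hj]
  refine ⟨fun j hj => h _ (hmem j hj), fun j hj => ?_, ?_, ?_⟩
  · refine (Nat.lt_size_self _).trans_le (Nat.pow_le_pow_right two_pos ?_)
    have := List.single_le_sum (l := l.map fun v => v.size + 1) (by simp) _
      (List.mem_map_of_mem (f := fun v => v.size + 1) (hmem j hj))
    exact (Nat.le_succ _).trans this
  · rw [entries_getD, Multiset.prod_coe]
    clear h hmem
    induction l with
    | nil => simp [bitSize]
    | cons a l ih =>
      have h1 : bitSize (a :: l) = (a.size + 1) + bitSize l := by simp [bitSize]
      rw [List.prod_cons, h1, pow_add]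
      refine Nat.mul_le_mul ((Nat.lt_size_self a).le.trans ?_) ih
      exact Nat.pow_le_pow_right two_pos (Nat.le_succ _)
  · clear h hmem
    induction l with
    | nil => simp [bitSize]
    | cons a l ih =>
      have h1 : bitSize (a :: l) = (a.size + 1) + bitSize l := by simp [bitSize]
      rw [List.length_cons, h1]; omega

theorem bounded_input {l : List ℕ} (h : ∀ x ∈ l, 0 < x) :
    (input l).Bounded (4 * bitSize l + 8) := by
  have B := sizeBound_getD h
  have hle : 2 ^ bitSize l < 2 ^ (4 * bitSize l + 8) :=
    Nat.pow_lt_pow_right (by norm_num) (by omega)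
  have hl : bitSize l < 2 ^ bitSize l := Nat.lt_two_pow_self
  have hn := B.le
  refine ⟨fun x => ?_, fun a i => ?_⟩
  · simp only [input]
    split
    · omega
    · positivity
  · simp only [input]
    split
    · by_cases hi : i < l.length
      · exact (B.lt i hi).trans hle
      · rw [List.getD_eq_default _ _ (not_lt.1 hi)]; positivity
    · positivity

/-- A bound on the cost of `reductionProg`. -/
noncomputable def costBound : Polynomial ℕ :=
  (7 * .X + 7 + ((2 * .X * (4 * .X ^ 2 + 1) + 4 * .X ^ 2) * (64 * .X + 165) + 3) +
    ((2 * .X * (.X + 1) + .X) * (34 * .X + 14) + 24 * .X + 11) +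
    (.X * (2 * .X * (.X + 1) + .X) * 17 + 11)) * (3 * (4 * .X + 8) + 1)

theorem eval_costBound (L : ℕ) : costBound.eval L = stepBound L * (3 * (4 * L + 8) + 1) := by
  simp [costBound, stepBound]

theorem output_eq_encode {n : ℕ} (Q : PCInstance n) (τ : State)
    (h : τ.reg 0 = Q.d + 2 + n * Q.d) (h0 : τ.arr 0 0 = Q.d) (h1 : τ.arr 0 1 = n)
    (hf : ∀ i : Fin Q.d, τ.arr 0 (i + 2) = Q.f i)
    (hs : ∀ (j : Fin n) (i : Fin Q.d), τ.arr 0 (Q.d + 2 + (j * Q.d + i)) =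
      if i ∈ Q.s j then 1 else 0) : τ.output = Q.encode := by
  have hofFn : ∀ (m : ℕ) (g : ℕ → ℕ), (List.range m).map g = List.ofFn fun i : Fin m => g i := by
    intro m g
    refine List.ext_getElem (by simp) fun i h1 h2 => ?_
    simp
  rw [State.output, h, add_comm Q.d 2, List.range_add, List.range_add, List.map_append,
    List.map_append, List.map_map, List.map_map, hofFn Q.d, hofFn (n * Q.d), List.ofFn_mul]
  have h2 : (List.range 2).map (τ.arr 0) = [Q.d, n] := by
    simp [List.range_succ, h0, h1]
  rw [h2, PCInstance.encode]
  simp only [List.cons_append, List.nil_append, Function.comp_apply]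
  congr 3
  · congr 1
    funext i
    rw [add_comm, hf]
  · congr 2
    funext j
    congr 1
    funext i
    rw [add_comm 2 Q.d]
    exact hs j i

end RAM

-- The digit code is read off from the run of the program, so that the computed output and the
-- instance with the proved properties are the same object.
open RAM in
theorem exists_reduction (P : WSInstance) : ∃ (M : Multiset ℕ) (d : ℕ) (f h : Fin d → ℕ)
    (C : IsDigitCode P.p (M.toFinset.erase 1) f h),
    IsSplitResult (Multiset.ofList (List.ofFn P.p)) M ∧
    ∃ (c : ℕ) (τ : State), Exec reductionProg (input P.encode) c τ ∧
      τ.output = C.toPCInstance.encode ∧ c ≤ costBound.eval (bitSize P.encode) := by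
  have hpos : ∀ x ∈ P.encode, 0 < x := by
    intro x hx
    obtain ⟨j, rfl⟩ := (List.mem_ofFn' _ _).1 hx
    exact P.pos j
  have hlen : P.encode.length = P.n := List.length_ofFn
  have B := sizeBound_getD hpos
  have hE := entries_getD P.encode
  rw [hlen] at B hE
  have hget : ∀ j : Fin P.n, P.encode.getD j 0 = P.p j := by
    intro j
    simp [WSInstance.encode]
  obtain ⟨c, τ, hexec, hc, -, M, d, F, G, H, hM, hbase, C, o0, o1, o2, oF, oB⟩ :=
    Within.reductionProg (σ := input P.encode) (n := P.n) B (by simp [input, hlen])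
      (bounded_input hpos)
  have harr : (input P.encode).arr 0 = fun i => P.encode.getD i 0 := rfl
  rw [harr] at C oB
  rw [harr, hE] at hM
  have hex : ∀ m, (∃ j < P.n, m ∣ P.encode.getD j 0) ↔ ∃ j, m ∣ P.p j := by
    intro m
    constructor
    · rintro ⟨j, hj, h⟩
      refine ⟨⟨j, hj⟩, ?_⟩
      rwa [← hget]
    · rintro ⟨j, h⟩
      exact ⟨j, j.2, by rwa [hget]⟩
  have hinv : SplitInvariant (P.encode : Multiset ℕ) M :=
    .of_reflTransGen (fun x hx => hpos x (by simpa using hx)) hM.1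
  have D : IsDigitCode P.p (M.toFinset.erase 1) (fun i : Fin d => F i) (fun i : Fin d => H i) := by
    refine ⟨hbase, fun j => ?_, fun x hx => ?_, fun i k hik => C.lex i k hik k.2, fun x t => ?_⟩
    · exact hinv.mem_closure_erase_one (by simp [WSInstance.encode])
    · rw [Finset.mem_erase, Multiset.mem_toFinset] at hx
      obtain ⟨y, hy, hxy⟩ := hinv.dvd x hx.2
      obtain ⟨j, rfl⟩ := (List.mem_ofFn' _ _).1 (Multiset.mem_coe.1 hy)
      exact ⟨j, hxy⟩
    · have h1 := C.mem_iff x t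
      rw [hex] at h1
      simp only [and_true] at h1
      rw [← h1]
      exact ⟨fun ⟨i, hi⟩ => ⟨i, i.2, hi⟩, fun ⟨i, hi, h⟩ => ⟨⟨i, hi⟩, h⟩⟩
  refine ⟨M, d, _, _, D, hM, c, τ, hexec, ?_, ?_⟩
  · refine output_eq_encode D.toPCInstance τ o0 o1 o2 (fun i => oF i i.2) fun j i => ?_
    have hi : (i : ℕ) < d := i.2
    show τ.arr 0 (d + 2 + (j * d + i)) = _
    have hlt : (j : ℕ) * d + i < P.n * d := by
      have := Nat.mul_le_mul_right d (Nat.succ_le_of_lt j.2)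
      rw [Nat.succ_mul] at this
      omega
    rw [oB _ hlt]
    have h7 : ((j : ℕ) * d + i) / d = j := by
      rw [mul_comm, Nat.mul_add_div (by omega), Nat.div_eq_of_lt hi, add_zero]
    have h8 : ((j : ℕ) * d + i) % d = i := by
      rw [mul_comm, Nat.mul_add_mod, Nat.mod_eq_of_lt hi]
    refine if_congr ?_ rfl rfl
    rw [h7, h8, C.pow i i.2]
    show F i ^ (H i + 1) ∣ P.encode.getD j 0 ↔ i ∈ IsDigitCode.attributes _ _ _
    rw [hget]
    simp [IsDigitCode.attributes]
  · rw [eval_costBound]; exact hc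

theorem mainTheorem4 :
    ∃ red : (P : WSInstance) → PCInstance P.n,
      RAM.PolyTimeComputable WSInstance.encode (fun P => (red P).encode) ∧
      ∀ P : WSInstance,
        -- the attributes form a relative prime factorization obtained by gcd splitting
        IsRelativePrimeFactorization (red P).f P.p ∧
        (∃ M : Multiset ℕ, IsSplitResult (Multiset.ofList (List.ofFn P.p)) M ∧
          Set.range (red P).f = {x | x ∈ M ∧ x ≠ 1}) ∧
        -- the symbol of each job
        (∀ j, IsLexLeastIndexSet (red P).f (P.p j) ((red P).s j)) ∧
        -- start times of each job correspond bijectively to encodings of its symbol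
        (∀ j, Function.Bijective
          (fun t : Fin (P.p j) => (red P).residueEncoding j (t : ℕ))) ∧
        -- collision means indistinguishability
        (∀ t : P.StartTimes, ∀ j k, j ≠ k →
          (P.Collide t j k ↔
            ¬ (red P).Distinguishable (fun l => (red P).residueEncoding l (t l : ℕ)) j k)) ∧
        -- feasible start times correspond to feasible encodings
        (∀ t : P.StartTimes,
          P.FeasibleStart t ↔
            (red P).Feasible (fun l => (red P).residueEncoding l (t l : ℕ))) ∧
        -- equivalence of the two decision problems
        (P.Solvable ↔ (red P).Solvable) := by
  -- Only the data of the instance are chosen for each `P`; the program and the cost polynomial are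
  -- fixed, as uniform computability demands.
  choose M d f h C hM c τ hexec hout hc using exists_reduction
  refine ⟨fun P => (C P).toPCInstance, ⟨RAM.reductionProg, RAM.costBound, fun P =>
    ⟨c P, τ P, hexec P, hout P, hc P⟩⟩, fun P => ⟨(C P).isRelativePrimeFactorization,
    ⟨M P, hM P, ?_⟩, (C P).isLexLeastIndexSet, (C P).residueEncoding_bijective,
    fun t j k _ => (C P).collide_iff t j k, (C P).feasibleStart_iff, (C P).solvable_iff⟩⟩
  refine (C P).range_eq.trans ?_
  ext x
  simp
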